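/- Let $\Omega:S^2\to\mathbb{C}$ be a smooth function on the unit sphere of $\mathbb{R}^3$ (for instance a real-valued one) with $\Omega(-\bar x)=\Omega(\bar x)$ for all $\bar x\in S^2$, and let $\mathfrak{S}=\{s\in\mathbb{C}: 0<\mathrm{Re}\,s<3\}$. For $x\neq 0$ write $\bar x=x/|x|\in S^2$. Let $\mathcal F$ be the Fourier transform of tempered distributions on $\mathbb{R}^3$, normalized by $\mathcal F[f](\xi)=\int_{\mathbb{R}^3} f(x)e^{-2\pi i x\cdot\xi}\,dx$. Then there is a function $\tilde\Omega(\bar\xi;s)$ of $\bar\xi\in S^2$ and $s\in\mathfrak S$, with values in $\mathbb{C}$, such that: 1. for every $s\in\mathfrak S$, the functions $|x|^{-s}\Omega(\bar x)$ and $|\xi|^{s-3}\tilde\Omega(\bar\xi;s)$ are locally integrable, define tempered distributions, and satisfy $$\mathcal F\big[|x|^{-s}\Omega(\bar x)\big]=|\xi|^{s-3}\,\tilde\Omega(\bar\xi;s);$$ 2. for every $s\in\mathfrak S$, $\tilde\Omega(\bar\xi;s)$ is smooth in $\bar\xi\in S^2$; for every $\bar\xi\in S^2$, it is holomorphic in $s\in\mathfrak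 S$; and for every $s\in\mathfrak S$, $\partial_s\tilde\Omega(\bar\xi;s)$ is smooth in $\bar\xi\in S^2$; 3. for every real $s$ with $2<s<3$ and every $\bar\xi\in S^2$, $$\tilde\Omega(\bar\xi;s)=\tau_{3-s}\int_{S^2}|\bar x\cdot\bar\xi|^{s-3}\,\Omega(\bar x)\,d\bar x,\qquad \tau_a=(2\pi)^{-a}\,\Gamma(a)\cos\frac{a\pi}{2},$$ where $d\bar x$ is the surface measure of $S^2$ and the integral converges absolutely; 4. for every $\bar\xi\in S^2$, $\tilde\Omega(\bar\xi;2)=\pi\,[\Omega]_{\bar\xi}$, where $$[\Omega]_{\bar\xi}=\frac1{2\pi}\int_{\{\bar x\in S^2:\ \bar x\cdot\bar\xi=0\}}\Omega(\bar x)\,d\bar x$$ is the average of $\Omega$, with respect to arc length, over the great circle orthogonal to $\bar\xi$. -/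

import Mathlib

open scoped SchwartzMap FourierTransform Manifold ContDiff Real

/-- Euclidean three-space. -/
abbrev E3 : Type := EuclideanSpace ℝ (Fin 3)

/-- The unit sphere `S²` of Euclidean three-space. -/
abbrev S2 : Type := Metric.sphere (0 : E3) 1

/-- `S²` is a two-dimensional manifold: the dimension fact behind its Mathlib manifold structure. -/
instance factFinrankE3 : Fact (Module.finrank ℝ E3 = 2 + 1) := ⟨by simp⟩

/-- The angle variable `x̄ = x / |x|` of `x ≠ 0` (with an arbitrary value, the north pole, at the
origin). -/
noncomputable def angle (x : E3) : S2 :=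
  if h : x = 0 then ⟨EuclideanSpace.single 2 1, by simp⟩
  else ⟨‖x‖⁻¹ • x, by
    rw [mem_sphere_zero_iff_norm, norm_smul, norm_inv, norm_norm,
      inv_mul_cancel₀ (norm_ne_zero_iff.mpr h)]⟩

/-- The function `x ↦ |x|^z Θ(x̄)` on three-space. -/
noncomputable def homogeneous (z : ℂ) (Θ : S2 → ℂ) (x : E3) : ℂ :=
  (‖x‖ : ℂ) ^ z * Θ (angle x)

/-- The tempered distribution `T` is (given by integration against) the locally integrable
function `f`. -/
def IsGivenBy (T : 𝓢'(E3, ℂ)) (f : E3 → ℂ) : Prop :=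
  MeasureTheory.LocallyIntegrable f ∧
    ∀ φ : 𝓢(E3, ℂ), MeasureTheory.Integrable (fun x => φ x * f x) ∧ T φ = ∫ x, φ x * f x

/-- `𝓕[f] = g` in the sense of tempered distributions: `f` defines a tempered distribution and its
distributional Fourier transform, with kernel `exp (-2πi x·ξ)`, is the function `g`. -/
def HasFourierTransform (f g : E3 → ℂ) : Prop :=
  ∃ T : 𝓢'(E3, ℂ), IsGivenBy T f ∧ IsGivenBy (𝓕 T) g

/-- The strip `0 < Re s < 3`. -/
def strip : Set ℂ := {s | 0 < s.re ∧ s.re < 3}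

/-- The constant `τ_s = (2π)^{-s} Γ(s) cos(sπ/2)`. -/
noncomputable def tau (s : ℝ) : ℝ := (2 * π) ^ (-s) * Real.Gamma s * Real.cos (s * π / 2)

/-- The surface measure of `S²` (total mass `4π`). -/
noncomputable def surfaceMeasure : MeasureTheory.Measure S2 :=
  (MeasureTheory.volume : MeasureTheory.Measure E3).toSphere

/-- The mean, with respect to arc length, of `Θ` over the great circle spanned by an orthonormal
pair `u`, `v`; `t ↦ cos t • u + sin t • v` is the parametrization by arc length. -/
noncomputable def circleMean (Θ : S2 → ℂ) (u v : E3) : ℂ :=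
  (2 * π : ℂ)⁻¹ * ∫ t in (0 : ℝ)..(2 * π), Θ (angle (Real.cos t • u + Real.sin t • v))

theorem exists_orthonormal_triple (ξ : S2) :
    ∃ p : E3 × E3, Orthonormal ℝ ![(ξ : E3), p.1, p.2] := by
  have hξ : ‖(ξ : E3)‖ = 1 := mem_sphere_zero_iff_norm.mp ξ.2
  have h1 : Orthonormal ℝ (({0} : Set (Fin 3)).domRestrict (fun _ => (ξ : E3))) := by
    refine ⟨fun _ => hξ, ?_⟩
    rintro ⟨i, hi⟩ ⟨j, hj⟩ hij
    exact absurd (Subtype.ext (hi.trans hj.symm)) hij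
  obtain ⟨b, hb⟩ := h1.exists_orthonormalBasis_extension_of_card_eq (by simp)
  refine ⟨(b 1, b 2), ?_⟩
  have h0 : b 0 = (ξ : E3) := hb 0 rfl
  have : ![(ξ : E3), b 1, b 2] = b := by
    funext i
    fin_cases i
    · exact h0.symm
    · rfl
    · rfl
  simp [this]

/-- `[Θ]_ξ`, the mean of `Θ` over the great circle `{x ∈ S² : x · ξ = 0}` with respect to arc
length. The circle is parametrized through an orthonormal pair orthogonal to `ξ`; by
`greatCircleMean_eq` the choice of the pair does not matter. -/
noncomputable def greatCircleMean (Θ : S2 → ℂ) (ξ : S2) : ℂ :=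
  circleMean Θ (exists_orthonormal_triple ξ).choose.1 (exists_orthonormal_triple ξ).choose.2

theorem circleMean_congr (Θ : S2 → ℂ) (ξ u v u' v' : E3)
    (h : Orthonormal ℝ ![ξ, u, v]) (h' : Orthonormal ℝ ![ξ, u', v']) :
    circleMean Θ u v = circleMean Θ u' v' := by
  have key : ∀ w : E3, inner ℝ ξ w = 0 → w = (inner ℝ u w : ℝ) • u + (inner ℝ v w : ℝ) • v := by
    intro w hw
    have hc : Fintype.card (Fin 3) = Module.finrank ℝ E3 := by simp
    let B := basisOfOrthonormalOfCardEqFinrank h hc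
    have hB : ⇑B = ![ξ, u, v] := coe_basisOfOrthonormalOfCardEqFinrank h hc
    let b := B.toOrthonormalBasis (by rw [hB]; exact h)
    have hb : ⇑b = ![ξ, u, v] := by simp [b, hB]
    have := b.sum_repr' w
    rw [Fin.sum_univ_three, hb] at this
    simpa [hw] using this.symm
  have ho := orthonormal_iff_ite.mp h
  have ho' := orthonormal_iff_ite.mp h'
  have huu : inner ℝ u u = (1 : ℝ) := by simpa using ho 1 1
  have hvv : inner ℝ v v = (1 : ℝ) := by simpa using ho 2 2
  have huv : inner ℝ u v = (0 : ℝ) := by simpa using ho 1 2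
  have hvu : inner ℝ v u = (0 : ℝ) := by simpa using ho 2 1
  have huu' : inner ℝ u' u' = (1 : ℝ) := by simpa using ho' 1 1
  have hvv' : inner ℝ v' v' = (1 : ℝ) := by simpa using ho' 2 2
  have huv' : inner ℝ u' v' = (0 : ℝ) := by simpa using ho' 1 2
  have hu' := key u' (by simpa using ho' 0 1)
  have hv' := key v' (by simpa using ho' 0 2)
  set a : ℝ := inner ℝ u u'
  set b : ℝ := inner ℝ v u'
  set c : ℝ := inner ℝ u v'
  set d : ℝ := inner ℝ v v'
  have e1 : a ^ 2 + b ^ 2 = 1 := by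
    rw [hu'] at huu'
    simp only [inner_add_left, inner_add_right, real_inner_smul_left, real_inner_smul_right, huu,
      hvv, huv, hvu] at huu'
    linarith
  have e2 : c ^ 2 + d ^ 2 = 1 := by
    rw [hv'] at hvv'
    simp only [inner_add_left, inner_add_right, real_inner_smul_left, real_inner_smul_right, huu,
      hvv, huv, hvu] at hvv'
    linarith
  have e3 : a * c + b * d = 0 := by
    rw [hu', hv'] at huv'
    simp only [inner_add_left, inner_add_right, real_inner_smul_left, real_inner_smul_right, huu,
      hvv, huv, hvu] at huv'
    linarith
  obtain ⟨α, hca, hsa⟩ : ∃ α : ℝ, Real.cos α = a ∧ Real.sin α = b := by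
    have hn : ‖(⟨a, b⟩ : ℂ)‖ = 1 := by
      rw [Complex.norm_def, Complex.normSq_mk, Real.sqrt_eq_one]; linarith
    have hz : (⟨a, b⟩ : ℂ) ≠ 0 := by
      intro h0; rw [h0] at hn; simp at hn
    refine ⟨Complex.arg ⟨a, b⟩, ?_, ?_⟩
    · rw [Complex.cos_arg hz, hn]; simp
    · rw [Complex.sin_arg, hn]; simp
  set G : ℝ → ℂ := fun t => Θ (angle (Real.cos t • u + Real.sin t • v)) with hG
  have hper : Function.Periodic G (2 * π) := fun t => by simp [hG]
  have hcd : (c = -b ∧ d = a) ∨ (c = b ∧ d = -a) := by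
    have hp : (a * d - b * c - 1) * (a * d - b * c + 1) = 0 := by
      linear_combination (c ^ 2 + d ^ 2) * e1 + e2 - (a * c + b * d) * e3
    have i1 : c = -b * (a * d - b * c) := by
      linear_combination (-c) * e1 + a * e3
    have i2 : d = a * (a * d - b * c) := by
      linear_combination (-d) * e1 + b * e3
    rcases mul_eq_zero.mp hp with h1 | h1
    · left
      have h2 : a * d - b * c = 1 := by linarith
      rw [h2] at i1 i2
      exact ⟨by linarith, by linarith⟩
    · right
      have h2 : a * d - b * c = -1 := by linarith
      rw [h2] at i1 i2
      exact ⟨by linarith, by linarith⟩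
  unfold circleMean
  congr 1
  rcases hcd with ⟨hc, hd⟩ | ⟨hc, hd⟩
  · have e : ∀ t : ℝ, Θ (angle (Real.cos t • u' + Real.sin t • v')) = G (t + α) := by
      intro t
      simp only [hG, Real.cos_add, Real.sin_add, hca, hsa]
      congr 2
      rw [hu', hv', hc, hd]
      module
    simp_rw [e]
    rw [intervalIntegral.integral_comp_add_right]
    have := hper.intervalIntegral_add_eq 0 (0 + α)
    rw [zero_add] at this
    rw [this]
    congr 1
    ring
  · have e : ∀ t : ℝ, Θ (angle (Real.cos t • u' + Real.sin t • v')) = G (α - t) := by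
      intro t
      simp only [hG, Real.cos_sub, Real.sin_sub, hca, hsa]
      congr 2
      rw [hu', hv', hc, hd]
      module
    simp_rw [e]
    rw [intervalIntegral.integral_comp_sub_left]
    have := hper.intervalIntegral_add_eq 0 (α - 2 * π)
    rw [zero_add] at this
    rw [this]
    congr 1
    ring

theorem greatCircleMean_eq (Θ : S2 → ℂ) (ξ : S2) (u v : E3)
    (h : Orthonormal ℝ ![(ξ : E3), u, v]) : greatCircleMean Θ ξ = circleMean Θ u v :=
  circleMean_congr Θ ξ _ _ u v (exists_orthonormal_triple ξ).choose_spec h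

/-! The homogeneous function is a superposition of dilates of one Schwartz function. For a smooth
`ψ` with compact support in `(0, ∞)`, the function `G(x) = ψ(|x|) Ω(x̄)` is Schwartz, and for `x ≠
0` the integral `∫₀^∞ t^(s-1) G(tx) dt` equals `M(s) |x|^(-s) Ω(x̄)`, where `M` is the Mellin
transform of `ψ`. The Fourier transform of `G(t·)` is `t⁻³ 𝓕G(·/t)`, so after `t ↦ 1/t` the
transform of the superposition is `∫₀^∞ t^(2-s) 𝓕G(tξ) dt`, which is homogeneous of degree `s - 3`.
Its restriction to the sphere is `fourierAngular`, and dividing by `M(s)` gives the required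
function. The duality behind this is `integral_fourier_mul_mellin_ray`. Smoothness in `ξ` and
holomorphy in `s` come from differentiating this integral, as `𝓕G` decays rapidly and `ξ ≠ 0`.

For `2 < s < 3`, polar coordinates express `𝓕G(tξ)` as an integral over the sphere of the
one-dimensional transform of `r² ψ(r)` at `t x·ξ`. Evenness replaces it by a cosine transform, and
Fubini leaves `|x·ξ|^(s-3)` times a one-dimensional constant. The same duality on the line, tested
against the Gaussian, identifies that constant as a ratio of `Complex.Gammaℝ` factors
(`mellin_fourier_add_comp_neg`).

A given `M` may have zeros, so the profile has to vary with `s`. The formula on `(2, 3)` and the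
identity theorem show that the quotient does not depend on the profile
(`fourierAngular_mul_mellin_comm`), so near each point a fixed profile suffices.

At `s = 2` the Mellin integral is half the integral of `𝓕G` over the line through `ξ`. By Fourier
slicing the whole line integral is the integral of `G` over the plane orthogonal to `ξ`, which is a
great-circle mean in polar coordinates. -/

section

open MeasureTheory Set Filter Topology

/-! ### The angle map and its smoothness -/

theorem coe_angle {x : E3} (hx : x ≠ 0) : (angle x : E3) = ‖x‖⁻¹ • x := by
  simp [angle, hx]

theorem norm_coe_S2 (x : S2) : ‖(x : E3)‖ = 1 := mem_sphere_zero_iff_norm.mp x.2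

theorem coe_S2_ne_zero (x : S2) : (x : E3) ≠ 0 := ne_zero_of_mem_unit_sphere x

theorem angle_coe (x : S2) : angle (x : E3) = x := by
  ext1
  rw [coe_angle (coe_S2_ne_zero x), norm_coe_S2]
  simp

theorem angle_smul {c : ℝ} (hc : 0 < c) (x : E3) (hx : x ≠ 0) : angle (c • x) = angle x := by
  ext1
  rw [coe_angle hx, coe_angle (smul_ne_zero hc.ne' hx), norm_smul, smul_smul, Real.norm_of_nonneg hc.le]
  congr 1
  field_simp

theorem angle_smul_coe {c : ℝ} (hc : 0 < c) (x : S2) : angle (c • (x : E3)) = x := by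
  rw [angle_smul hc _ (coe_S2_ne_zero x), angle_coe]

theorem angle_neg {x : E3} (hx : x ≠ 0) : angle (-x) = -angle x := by
  ext1
  rw [coe_angle (neg_ne_zero.mpr hx), coe_neg_sphere, coe_angle hx]
  simp

theorem norm_smul_angle {x : E3} (hx : x ≠ 0) : ‖x‖ • (angle x : E3) = x := by
  rw [coe_angle hx, smul_smul, mul_inv_cancel₀ (norm_ne_zero_iff.mpr hx), one_smul]

/-- Smoothness into the sphere is inherited from the ambient map `x ↦ x / ‖x‖`. That map takes
values in the sphere only off the origin, hence the passage through the open submanifold `{0}ᶜ`. -/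
theorem contMDiffAt_angle {x : E3} (hx : x ≠ 0) : ContMDiffAt 𝓘(ℝ, E3) (𝓡 2) ∞ angle x := by
  let U : TopologicalSpace.Opens E3 := ⟨{0}ᶜ, isOpen_compl_singleton⟩
  have hU : ∀ y : U, (y : E3) ≠ 0 := fun y => y.2
  have h1 : ContMDiff 𝓘(ℝ, E3) 𝓘(ℝ, E3) ∞ (fun y : U => ‖(y : E3)‖⁻¹ • (y : E3)) := by
    intro y
    have : ContMDiffAt 𝓘(ℝ, E3) 𝓘(ℝ, E3) ∞ (fun y : E3 => ‖y‖⁻¹ • y) (y : E3) := by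
      refine ContDiffAt.contMDiffAt ?_
      exact ((contDiffAt_norm ℝ (hU y)).inv (norm_ne_zero_iff.mpr (hU y))).smul contDiffAt_id
    exact contMDiffAt_subtype_iff.mpr this
  have h2 : ∀ y : U, ‖(y : E3)‖⁻¹ • (y : E3) ∈ Metric.sphere (0 : E3) 1 := fun y => by
    rw [← coe_angle (hU y)]; exact (angle (y : E3)).2
  have h3 := h1.codRestrict_sphere (n := 2) h2
  have h4 : (Set.codRestrict _ _ h2 : U → S2) = fun y : U => angle (y : E3) := by
    funext y
    ext1
    simp [coe_angle (hU y)]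
  rw [h4] at h3
  exact contMDiffAt_subtype_iff.mp (h3 ⟨x, hx⟩)

theorem contDiffAt_comp_angle {Θ : S2 → ℂ} (hΘ : ContMDiff (𝓡 2) 𝓘(ℝ, ℂ) ∞ Θ) {x : E3}
    (hx : x ≠ 0) : ContDiffAt ℝ ∞ (fun y => Θ (angle y)) x :=
  (hΘ.contMDiffAt.comp x (contMDiffAt_angle hx)).contDiffAt

theorem continuousOn_comp_angle {Θ : S2 → ℂ} (hΘ : Continuous Θ) :
    ContinuousOn (fun y => Θ (angle y)) {0}ᶜ := fun _ hx =>
  (hΘ.continuousAt.comp (contMDiffAt_angle hx).continuousAt).continuousWithinAt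

theorem ContDiffOn.contMDiff_restrict_sphere {f : E3 → ℂ} (hf : ContDiffOn ℝ ∞ f {0}ᶜ) :
    ContMDiff (𝓡 2) 𝓘(ℝ, ℂ) ∞ (fun ξ : S2 => f ξ) := by
  intro ξ
  have h : ContMDiffAt 𝓘(ℝ, E3) 𝓘(ℝ, ℂ) ∞ f (ξ : E3) :=
    (hf.contDiffAt (isOpen_compl_singleton.mem_nhds (coe_S2_ne_zero ξ))).contMDiffAt
  exact h.comp ξ (contMDiff_coe_sphere ξ)

/-! ### Radial profiles and the Schwartz functions built from them -/

/-- A smooth function with compact support in the open half-line `(0, ∞)`. -/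
structure IsProfile (ψ : ℝ → ℂ) : Prop where
  contDiff : ContDiff ℝ ∞ ψ
  compact : HasCompactSupport ψ
  support : tsupport ψ ⊆ Ioi 0

namespace IsProfile

variable {ψ : ℝ → ℂ} (hψ : IsProfile ψ)
include hψ

theorem exists_bounds : ∃ δ R : ℝ, 0 < δ ∧ δ < R ∧ ∀ r, ψ r ≠ 0 → δ ≤ r ∧ r ≤ R := by
  rcases (tsupport ψ).eq_empty_or_nonempty with h | h
  · refine ⟨1, 2, one_pos, by norm_num, fun r hr => ?_⟩
    have := subset_tsupport ψ hr
    rw [h] at this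
    exact this.elim
  · obtain ⟨a, ha, ha'⟩ := hψ.compact.isCompact.exists_isLeast h
    obtain ⟨b, hb, hb'⟩ := hψ.compact.isCompact.exists_isGreatest h
    refine ⟨a, b + 1, hψ.support ha, by linarith [ha' hb], fun r hr => ?_⟩
    have hr' := subset_tsupport ψ hr
    exact ⟨ha' hr', by linarith [hb' hr']⟩

theorem eq_zero_of_nonpos {r : ℝ} (hr : r ≤ 0) : ψ r = 0 := by
  obtain ⟨δ, R, hδ, -, h⟩ := hψ.exists_bounds
  by_contra h0
  linarith [(h r h0).1]

theorem isBigO_zero (b : ℝ) : ψ =O[𝓝[>] 0] (fun t : ℝ => t ^ b) := by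
  obtain ⟨δ, R, hδ, -, h⟩ := hψ.exists_bounds
  refine (Asymptotics.isBigO_zero _ _).congr' ?_ EventuallyEq.rfl
  filter_upwards [mem_nhdsWithin_of_mem_nhds (Iio_mem_nhds hδ)] with y hy
  by_contra h0
  exact absurd (h y (Ne.symm h0)).1 (not_le.mpr hy)

theorem isBigO_top (b : ℝ) : ψ =O[atTop] (fun t : ℝ => t ^ b) := by
  obtain ⟨δ, R, hδ, -, h⟩ := hψ.exists_bounds
  refine (Asymptotics.isBigO_zero _ _).congr' ?_ EventuallyEq.rfl
  filter_upwards [eventually_gt_atTop R] with y hy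
  by_contra h0
  exact absurd (h y (Ne.symm h0)).2 (not_le.mpr hy)

theorem locallyIntegrableOn : LocallyIntegrableOn ψ (Ioi 0) :=
  (hψ.contDiff.continuous.locallyIntegrable).locallyIntegrableOn _

/-- A profile vanishes near `0` and near infinity, so there is no restriction on the exponent. -/
theorem differentiable_mellin : Differentiable ℂ (mellin ψ) := fun s =>
  mellin_differentiableAt_of_isBigO_rpow hψ.locallyIntegrableOn (hψ.isBigO_top (-(s.re + 1)))
    (by linarith) (by simpa using hψ.isBigO_zero (-(s.re - 1))) (b := s.re - 1) (by linarith)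

end IsProfile

/-- The function `x ↦ ψ(|x|) Θ(x̄)`. -/
noncomputable def polarProduct (ψ : ℝ → ℂ) (Θ : S2 → ℂ) (x : E3) : ℂ := ψ ‖x‖ * Θ (angle x)

theorem polarProduct_smul_coe (ψ : ℝ → ℂ) (Θ : S2 → ℂ) {r : ℝ} (hr : 0 < r) (x : S2) :
    polarProduct ψ Θ (r • (x : E3)) = ψ r * Θ x := by
  rw [polarProduct, angle_smul_coe hr, norm_smul, norm_coe_S2, mul_one, Real.norm_of_nonneg hr.le]

section
variable {ψ : ℝ → ℂ} (hψ : IsProfile ψ) {Θ : S2 → ℂ} (hΘ : ContMDiff (𝓡 2) 𝓘(ℝ, ℂ) ∞ Θ)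
include hψ

theorem hasCompactSupport_polarProduct (Θ : S2 → ℂ) : HasCompactSupport (polarProduct ψ Θ) := by
  obtain ⟨δ, R, hδ, -, h⟩ := hψ.exists_bounds
  refine HasCompactSupport.intro (isCompact_closedBall (0 : E3) R) fun x hx => ?_
  rw [polarProduct]
  by_cases h0 : ψ ‖x‖ = 0
  · simp [h0]
  · exact absurd (by simpa using (h _ h0).2) hx

include hΘ

/-- The singularity of the angle at the origin is invisible because `ψ` vanishes on a neighbourhood
of `0`. -/
theorem contDiff_polarProduct : ContDiff ℝ ∞ (polarProduct ψ Θ) := by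
  obtain ⟨δ, R, hδ, -, h⟩ := hψ.exists_bounds
  rw [contDiff_iff_contDiffAt]
  intro x
  by_cases hx : x = 0
  · refine (contDiffAt_const (c := (0 : ℂ))).congr_of_eventuallyEq ?_
    filter_upwards [Metric.ball_mem_nhds x hδ] with y hy
    rw [hx, mem_ball_zero_iff] at hy
    have : ψ ‖y‖ = 0 := by
      by_contra h0
      linarith [(h _ h0).1]
    simp [polarProduct, this]
  · exact (hψ.contDiff.contDiffAt.comp x (contDiffAt_norm ℝ hx)).mul (contDiffAt_comp_angle hΘ hx)

end

/-- `polarProduct ψ Θ` as a Schwartz function. -/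
noncomputable def polarSchwartz {ψ : ℝ → ℂ} (hψ : IsProfile ψ) {Θ : S2 → ℂ}
    (hΘ : ContMDiff (𝓡 2) 𝓘(ℝ, ℂ) ∞ Θ) : 𝓢(E3, ℂ) :=
  (hasCompactSupport_polarProduct hψ Θ).toSchwartzMap (contDiff_polarProduct hψ hΘ)

theorem polarSchwartz_apply {ψ : ℝ → ℂ} (hψ : IsProfile ψ) {Θ : S2 → ℂ}
    (hΘ : ContMDiff (𝓡 2) 𝓘(ℝ, ℂ) ∞ Θ) (x : E3) :
    polarSchwartz hψ hΘ x = polarProduct ψ Θ x := rfl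

/-! ### Rapid decay and Mellin transforms along rays -/

section decay
variable {E V : Type*} [NormedAddCommGroup E] [NormedSpace ℝ E] [NormedAddCommGroup V]

/-- A continuous function which decays faster than any power of the norm. -/
structure RapidDecay (F : E → V) : Prop where
  continuous : Continuous F
  bound : ∀ k : ℕ, ∃ C : ℝ, 0 ≤ C ∧ ∀ x, ‖F x‖ ≤ C / (1 + ‖x‖) ^ k

theorem SchwartzMap.rapidDecay [NormedSpace ℝ V] (F : 𝓢(E, V)) : RapidDecay F := by
  refine ⟨F.continuous, fun k => ⟨2 ^ k * ((Finset.Iic (k, 0)).sup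
    (fun m => SchwartzMap.seminorm ℝ m.1 m.2)) F, by positivity, fun x => ?_⟩⟩
  rw [le_div_iff₀' (by positivity)]
  simpa using SchwartzMap.one_add_le_sup_seminorm_apply (𝕜 := ℝ) (m := (k, 0)) (k := k) (n := 0)
    le_rfl le_rfl F x

namespace RapidDecay

/-- Uniformity in `x` away from the origin is what allows differentiation under the ray integral. It
rests on `1 + t‖x‖ ≥ min ρ 1 * (1 + t)`. -/
theorem exists_norm_smul_le_div_pow {F : E → V} (hF : RapidDecay F) (k : ℕ) {ρ : ℝ} (hρ : 0 < ρ) :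
    ∃ C : ℝ, 0 ≤ C ∧ ∀ x, ρ ≤ ‖x‖ → ∀ t : ℝ, 0 < t → ‖F (t • x)‖ ≤ C / (1 + t) ^ k := by
  obtain ⟨C, hC, h⟩ := hF.bound k
  set c := min ρ 1
  have hc : 0 < c := lt_min hρ one_pos
  refine ⟨C / c ^ k, by positivity, fun x hx t ht => (h _).trans ?_⟩
  rw [div_div, ← mul_pow]
  gcongr
  rw [norm_smul, Real.norm_of_nonneg ht.le, mul_add, mul_one, mul_comm c t]
  gcongr
  · exact min_le_right _ _
  · exact (min_le_left _ _).trans hx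

theorem isBigO_ray_top {F : E → V} (hF : RapidDecay F) {x : E} (hx : x ≠ 0) (k : ℕ) :
    (fun t : ℝ => F (t • x)) =O[atTop] (fun t : ℝ => t ^ (-(k : ℝ))) := by
  obtain ⟨C, hC, h⟩ := hF.exists_norm_smul_le_div_pow k (norm_pos_iff.mpr hx)
  refine Asymptotics.IsBigO.of_bound C ?_
  filter_upwards [eventually_gt_atTop 0] with t ht
  refine (h x le_rfl t ht).trans ?_
  rw [Real.norm_of_nonneg (by positivity), Real.rpow_neg ht.le, Real.rpow_natCast, ← div_eq_mul_inv]
  gcongr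
  linarith

theorem isBigO_ray_zero {F : E → V} (hF : RapidDecay F) (x : E) :
    (fun t : ℝ => F (t • x)) =O[𝓝[>] 0] (fun t : ℝ => t ^ (-(0 : ℝ))) := by
  obtain ⟨C, hC, h⟩ := hF.bound 0
  refine Asymptotics.IsBigO.of_bound C (Eventually.of_forall fun t => ?_)
  simpa using h (t • x)

theorem continuous_ray {F : E → V} (hF : RapidDecay F) (x : E) :
    Continuous (fun t : ℝ => F (t • x)) :=
  hF.continuous.comp (by fun_prop)

theorem hasDerivAt_mellin_ray {F : E → ℂ} (hF : RapidDecay F) {x : E} (hx : x ≠ 0)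
    {s : ℂ} (hs : 0 < s.re) :
    MellinConvergent (fun t : ℝ => Real.log t • F (t • x)) s ∧
      HasDerivAt (mellin (fun t : ℝ => F (t • x)))
        (mellin (fun t : ℝ => Real.log t • F (t • x)) s) s := by
  obtain ⟨k, hk⟩ := exists_nat_gt s.re
  exact mellin_hasDerivAt_of_isBigO_rpow
    ((hF.continuous_ray x).locallyIntegrable.locallyIntegrableOn _) (hF.isBigO_ray_top hx k) hk
    (hF.isBigO_ray_zero x) hs

theorem mellinConvergent_ray {F : E → ℂ} (hF : RapidDecay F) {x : E} (hx : x ≠ 0)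
    {s : ℂ} (hs : 0 < s.re) : MellinConvergent (fun t : ℝ => F (t • x)) s := by
  obtain ⟨k, hk⟩ := exists_nat_gt s.re
  exact mellinConvergent_of_isBigO_rpow
    ((hF.continuous_ray x).locallyIntegrable.locallyIntegrableOn _) (hF.isBigO_ray_top hx k) hk
    (hF.isBigO_ray_zero x) hs

end RapidDecay

end decay

/-! ### Smooth dependence of ray integrals on the direction -/

/-- A weight on the half-line `(0, ∞)` which is integrable against some power of `(1 + t)⁻¹`. -/
def IsRayWeight (w : ℝ → ℝ) : Prop :=
  ∃ k : ℕ, IntegrableOn (fun t => w t / (1 + t) ^ k) (Ioi 0)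

theorem IsRayWeight.aestronglyMeasurable {w : ℝ → ℝ} (hw : IsRayWeight w) :
    AEStronglyMeasurable w (volume.restrict (Ioi 0)) := by
  obtain ⟨k, hk⟩ := hw
  have h : AEStronglyMeasurable (fun t : ℝ => (1 + t) ^ k * (w t / (1 + t) ^ k))
      (volume.restrict (Ioi 0)) :=
    (by fun_prop : Continuous fun t : ℝ => (1 + t) ^ k).aestronglyMeasurable.mul
      hk.aestronglyMeasurable
  refine h.congr ?_
  filter_upwards [ae_restrict_mem measurableSet_Ioi] with t ht
  have : 0 < 1 + t := by linarith [mem_Ioi.mp ht]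
  field_simp

/-- Each derivative of `F (t • x)` in `x` produces a factor `t`; one more power of `1 + t` absorbs
it, so the class of weights is stable under differentiation. -/
theorem IsRayWeight.mul_id {w : ℝ → ℝ} (hw : IsRayWeight w) : IsRayWeight (fun t => w t * t) := by
  have hm := hw.aestronglyMeasurable
  obtain ⟨k, hk⟩ := hw
  refine ⟨k + 1, Integrable.mono hk ?_ ?_⟩
  · refine (hm.mul continuous_id.aestronglyMeasurable).mul ?_
    refine ContinuousOn.aestronglyMeasurable ?_ measurableSet_Ioi
    refine ContinuousOn.inv₀ (by fun_prop) fun t ht => ?_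
    have : 0 < 1 + t := by linarith [mem_Ioi.mp ht]
    positivity
  · filter_upwards [ae_restrict_mem measurableSet_Ioi] with t ht
    rw [mem_Ioi] at ht
    have h1 : 0 < 1 + t := by linarith
    rw [norm_div, norm_div, norm_mul, Real.norm_of_nonneg ht.le,
      Real.norm_of_nonneg (by positivity : 0 ≤ (1 + t) ^ (k + 1)),
      Real.norm_of_nonneg (by positivity : 0 ≤ (1 + t) ^ k), div_le_div_iff₀ (by positivity)
      (by positivity), pow_succ]
    have : 0 ≤ ‖w t‖ * (1 + t) ^ k := by positivity
    nlinarith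

section
variable {E V : Type} [NormedAddCommGroup E] [NormedSpace ℝ E] [NormedAddCommGroup V]
  [NormedSpace ℝ V]

theorem IsRayWeight.exists_bound {w : ℝ → ℝ} (hw : IsRayWeight w) (F : 𝓢(E, V)) {ρ : ℝ}
    (hρ : 0 < ρ) : ∃ b : ℝ → ℝ, IntegrableOn b (Ioi 0) ∧
      ∀ t ∈ Ioi (0 : ℝ), ∀ x, ρ ≤ ‖x‖ → ‖w t • F (t • x)‖ ≤ b t := by
  obtain ⟨k, hk⟩ := hw
  obtain ⟨C, hC, h⟩ := F.rapidDecay.exists_norm_smul_le_div_pow k hρ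
  refine ⟨fun t => ‖w t / (1 + t) ^ k‖ * C, hk.norm.mul_const C, fun t ht x hx => ?_⟩
  rw [mem_Ioi] at ht
  have h1 : 0 < 1 + t := by linarith
  beta_reduce
  rw [norm_smul, norm_div, Real.norm_of_nonneg (by positivity : 0 ≤ (1 + t) ^ k), div_mul_eq_mul_div,
    mul_div_assoc]
  gcongr
  exact h x hx t ht

theorem IsRayWeight.aestronglyMeasurable_smul {w : ℝ → ℝ} (hw : IsRayWeight w) (F : 𝓢(E, V))
    (x : E) : AEStronglyMeasurable (fun t => w t • F (t • x)) (volume.restrict (Ioi 0)) :=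
  hw.aestronglyMeasurable.smul (F.rapidDecay.continuous_ray x).aestronglyMeasurable

/-- The ball of radius `‖x‖ / 2` about `x` stays at distance at least `‖x‖ / 2` from the origin, so
a single integrable bound dominates the derivative there. -/
theorem IsRayWeight.hasFDerivAt {w : ℝ → ℝ} (hw : IsRayWeight w) (F : 𝓢(E, V)) {x : E}
    (hx : x ≠ 0) : HasFDerivAt (fun x => ∫ t in Ioi (0 : ℝ), w t • F (t • x))
      (∫ t in Ioi (0 : ℝ), (w t * t) • SchwartzMap.fderivCLM ℝ E V F (t • x)) x := by
  have hρ : 0 < ‖x‖ / 2 := half_pos (norm_pos_iff.mpr hx)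
  have hball : ∀ y ∈ Metric.ball x (‖x‖ / 2), ‖x‖ / 2 ≤ ‖y‖ := fun y hy => by
    have h1 : ‖y - x‖ < ‖x‖ / 2 := by simpa [dist_eq_norm] using hy
    have h2 : ‖x‖ ≤ ‖y‖ + ‖y - x‖ := by
      simpa using norm_sub_le y (y - x)
    linarith
  obtain ⟨b, hb, hbound⟩ := hw.mul_id.exists_bound (SchwartzMap.fderivCLM ℝ E V F) hρ
  obtain ⟨b', hb', hbound'⟩ := hw.exists_bound F hρ
  refine hasFDerivAt_integral_of_dominated_of_fderiv_le (bound := b)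
    (F' := fun y t => (w t * t) • SchwartzMap.fderivCLM ℝ E V F (t • y))
    (Metric.ball_mem_nhds x hρ) (Eventually.of_forall fun y => hw.aestronglyMeasurable_smul F y)
    ?_ (hw.mul_id.aestronglyMeasurable_smul _ x) ?_ hb ?_
  · refine Integrable.mono' hb' (hw.aestronglyMeasurable_smul F x) ?_
    filter_upwards [ae_restrict_mem measurableSet_Ioi] with t ht
    exact hbound' t ht x (by linarith)
  · filter_upwards [ae_restrict_mem measurableSet_Ioi] with t ht y hy
    exact hbound t ht y (hball y hy)
  · refine Eventually.of_forall fun t y _ => ?_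
    have h1 : HasFDerivAt F (SchwartzMap.fderivCLM ℝ E V F (t • y)) (t • y) := by
      simpa using F.differentiableAt.hasFDerivAt
    have h2 : HasFDerivAt (fun y : E => t • y) (t • ContinuousLinearMap.id ℝ E) y :=
      (hasFDerivAt_id y).const_smul t
    convert! (h1.comp y h2).const_smul (w t) using 1
    ext v
    simp [mul_smul]

end

/-- The derivative is again a ray integral, with weight `w t * t` and the Schwartz function `fderiv
F`. The induction therefore runs over all weights and all target spaces at once. -/
theorem IsRayWeight.contDiffOn_nat {E : Type} [NormedAddCommGroup E] [NormedSpace ℝ E] (n : ℕ) :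
    ∀ {V : Type} [NormedAddCommGroup V] [NormedSpace ℝ V] {w : ℝ → ℝ}, IsRayWeight w →
      ∀ F : 𝓢(E, V), ContDiffOn ℝ n (fun x => ∫ t in Ioi (0 : ℝ), w t • F (t • x)) {0}ᶜ := by
  induction n with
  | zero =>
    intro V _ _ w hw F
    exact contDiffOn_zero.mpr fun x hx =>
      (hw.hasFDerivAt F hx).continuousAt.continuousWithinAt
  | succ n ih =>
    intro V _ _ w hw F
    rw [Nat.cast_add, Nat.cast_one, contDiffOn_succ_iff_fderiv_of_isOpen isOpen_compl_singleton]
    refine ⟨fun x hx => (hw.hasFDerivAt F hx).differentiableAt.differentiableWithinAt,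
      by simp, ?_⟩
    exact (ih hw.mul_id (SchwartzMap.fderivCLM ℝ E V F)).congr
      fun x hx => (hw.hasFDerivAt F hx).fderiv

theorem IsRayWeight.contDiffOn {E V : Type} [NormedAddCommGroup E] [NormedSpace ℝ E]
    [NormedAddCommGroup V] [NormedSpace ℝ V] {w : ℝ → ℝ} (hw : IsRayWeight w) (F : 𝓢(E, V)) :
    ContDiffOn ℝ ∞ (fun x => ∫ t in Ioi (0 : ℝ), w t • F (t • x)) {0}ᶜ :=
  contDiffOn_infty.mpr fun n => contDiffOn_nat n hw F

theorem contDiffOn_rayIntegral {E : Type} [NormedAddCommGroup E] [NormedSpace ℝ E] {w : ℝ → ℂ}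
    (hre : IsRayWeight fun t => (w t).re) (him : IsRayWeight fun t => (w t).im) (F : 𝓢(E, ℂ)) :
    ContDiffOn ℝ ∞ (fun x => ∫ t in Ioi (0 : ℝ), w t * F (t • x)) {0}ᶜ := by
  have h : ∀ x ∈ ({0}ᶜ : Set E), ∫ t in Ioi (0 : ℝ), w t * F (t • x) =
      (∫ t in Ioi (0 : ℝ), (w t).re • F (t • x)) +
        Complex.I * ∫ t in Ioi (0 : ℝ), (w t).im • F (t • x) := by
    intro x hx
    have hint : ∀ {w : ℝ → ℝ}, IsRayWeight w →
        IntegrableOn (fun t => w t • F (t • x)) (Ioi 0) := by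
      intro w hw
      obtain ⟨b, hb, hbound⟩ := hw.exists_bound F (norm_pos_iff.mpr hx)
      refine Integrable.mono' hb (hw.aestronglyMeasurable_smul F x) ?_
      filter_upwards [ae_restrict_mem measurableSet_Ioi] with t ht
      exact hbound t ht x le_rfl
    rw [← integral_const_mul, ← integral_add (hint hre) ((hint him).const_mul _)]
    congr 1 with t
    conv_lhs => rw [← Complex.re_add_im (w t)]
    simp only [Complex.real_smul]
    ring
  exact ((hre.contDiffOn F).add (contDiffOn_const.mul (him.contDiffOn F))).congr h

theorem isBigO_one_div_pow_top (k : ℕ) :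
    (fun t : ℝ => (1 / (1 + t) ^ k : ℂ)) =O[atTop] (fun t : ℝ => t ^ (-(k : ℝ))) := by
  refine Asymptotics.IsBigO.of_bound 1 ?_
  filter_upwards [eventually_gt_atTop 0] with t ht
  rw [one_mul, Real.norm_of_nonneg (by positivity), Real.rpow_neg ht.le, Real.rpow_natCast,
    norm_div, norm_one, norm_pow, ← Complex.ofReal_one, ← Complex.ofReal_add, Complex.norm_real,
    Real.norm_of_nonneg (by positivity), ← one_div]
  gcongr
  linarith

/-- These are the Mellin integrals of `(1 + t)^(-k)`, bounded near `0` and `O(t^(-k))` at infinity,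
and of its product with the logarithm, which is the `z`-derivative. Any `k > Re z` works for both.
-/
theorem exists_integrable_mellin_kernel {z : ℂ} (hz : 0 < z.re) : ∃ k : ℕ,
    IntegrableOn (fun t : ℝ => (t : ℂ) ^ (z - 1) / ((1 + t : ℝ) : ℂ) ^ k) (Ioi 0) ∧
    IntegrableOn (fun t : ℝ => (t : ℂ) ^ (z - 1) * Real.log t / ((1 + t : ℝ) : ℂ) ^ k)
      (Ioi 0) := by
  obtain ⟨k, hk⟩ := exists_nat_gt z.re
  have hcont : ContinuousOn (fun t : ℝ => (1 / (1 + t) ^ k : ℂ)) (Ioi 0) := by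
    refine ContinuousOn.div (by fun_prop) (by fun_prop) fun t ht => ?_
    rw [mem_Ioi] at ht
    have : (1 + t : ℝ) ≠ 0 := by positivity
    exact pow_ne_zero _ (by exact_mod_cast this)
  have hloc : LocallyIntegrableOn (fun t : ℝ => (1 / (1 + t) ^ k : ℂ)) (Ioi 0) :=
    hcont.locallyIntegrableOn measurableSet_Ioi
  have hzero : (fun t : ℝ => (1 / (1 + t) ^ k : ℂ)) =O[𝓝[>] 0] (fun t : ℝ => t ^ (-(0 : ℝ))) := by
    refine Asymptotics.IsBigO.of_bound 1 ?_
    filter_upwards [self_mem_nhdsWithin] with t ht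
    rw [mem_Ioi] at ht
    rw [neg_zero, Real.rpow_zero, norm_one, one_mul, norm_div, norm_one, norm_pow,
      ← Complex.ofReal_one, ← Complex.ofReal_add, Complex.norm_real,
      Real.norm_of_nonneg (by positivity)]
    refine div_le_one_of_le₀ (one_le_pow₀ (by linarith)) (by positivity)
  refine ⟨k, ?_, ?_⟩
  · refine IntegrableOn.congr_fun (mellinConvergent_of_isBigO_rpow hloc (isBigO_one_div_pow_top k) hk
      hzero hz) (fun t _ => ?_) measurableSet_Ioi
    simp [div_eq_mul_inv]
  · refine IntegrableOn.congr_fun (mellin_hasDerivAt_of_isBigO_rpow hloc (isBigO_one_div_pow_top k)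
      hk hzero hz).1 (fun t _ => ?_) measurableSet_Ioi
    simp [div_eq_mul_inv, mul_assoc]

theorem isRayWeight_re_im {w : ℝ → ℂ} {k : ℕ}
    (h : IntegrableOn (fun t : ℝ => w t / ((1 + t : ℝ) : ℂ) ^ k) (Ioi 0)) :
    IsRayWeight (fun t => (w t).re) ∧ IsRayWeight (fun t => (w t).im) := by
  refine ⟨⟨k, IntegrableOn.congr_fun h.re (fun t _ => ?_) measurableSet_Ioi⟩,
    ⟨k, IntegrableOn.congr_fun h.im (fun t _ => ?_) measurableSet_Ioi⟩⟩
  · simp [← Complex.ofReal_pow, -Complex.ofReal_add]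
  · simp [← Complex.ofReal_pow, -Complex.ofReal_add]

theorem contDiffOn_mellin_ray {E : Type} [NormedAddCommGroup E] [NormedSpace ℝ E] (F : 𝓢(E, ℂ))
    {z : ℂ} (hz : 0 < z.re) :
    ContDiffOn ℝ ∞ (fun x => mellin (fun t : ℝ => F (t • x)) z) {0}ᶜ ∧
      ContDiffOn ℝ ∞ (fun x => mellin (fun t : ℝ => Real.log t • F (t • x)) z) {0}ᶜ := by
  obtain ⟨k, h1, h2⟩ := exists_integrable_mellin_kernel hz
  obtain ⟨h1, h1'⟩ := isRayWeight_re_im h1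
  obtain ⟨h2, h2'⟩ := isRayWeight_re_im h2
  refine ⟨contDiffOn_rayIntegral h1 h1' F, ?_⟩
  refine (contDiffOn_rayIntegral h2 h2' F).congr fun x _ => ?_
  simp [mellin, mul_assoc]

/-! ### Homogeneous functions as tempered distributions -/

theorem finrank_E3 : Module.finrank ℝ E3 = 3 := by simp

section
variable {E : Type*} [NormedAddCommGroup E] [InnerProductSpace ℝ E] [FiniteDimensional ℝ E]
  [Nontrivial E] [MeasurableSpace E] [BorelSpace E]

theorem exists_integrable_norm_rpow {w : ℝ} (hw : -(Module.finrank ℝ E : ℝ) < w) :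
    ∃ k : ℕ, Integrable (fun x : E => ‖x‖ ^ w / (1 + ‖x‖) ^ k) := by
  set n := Module.finrank ℝ E with hn
  have hn1 : 1 ≤ n := Module.finrank_pos
  -- In polar coordinates the radial integrand is `t^(w + n - 1) / (1 + t)^k`, the Mellin kernel of
  -- exponent `w + n > 0`.
  obtain ⟨k, hk, -⟩ := exists_integrable_mellin_kernel (z := ((w + n : ℝ) : ℂ))
    (by rw [Complex.ofReal_re]; linarith)
  refine ⟨k, (integrable_fun_norm_addHaar volume (f := fun y : ℝ => y ^ w / (1 + y) ^ k)).mpr ?_⟩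
  refine IntegrableOn.congr_fun hk.norm (fun t ht => ?_) measurableSet_Ioi
  rw [mem_Ioi] at ht
  have h1 : (w + n - 1 : ℝ) = w + ((n - 1 : ℕ) : ℝ) := by
    rw [Nat.cast_sub hn1, Nat.cast_one]
    ring
  rw [← hn, norm_div, norm_pow, Complex.norm_real, Real.norm_of_nonneg (by positivity),
    Complex.norm_cpow_eq_rpow_re_of_pos ht, Complex.sub_re, Complex.ofReal_re, Complex.one_re, h1,
    Real.rpow_add ht, smul_eq_mul, Real.rpow_natCast]
  ring

theorem RapidDecay.integrable_mul_norm_rpow {F : E → ℂ} (hF : RapidDecay F) {w : ℝ}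
    (hw : -(Module.finrank ℝ E : ℝ) < w) : Integrable (fun x : E => ‖F x‖ * ‖x‖ ^ w) := by
  obtain ⟨k, hk⟩ := exists_integrable_norm_rpow hw
  obtain ⟨C, hC, h⟩ := hF.bound k
  refine (hk.const_mul C).mono' ?_ (Eventually.of_forall fun x => ?_)
  · exact (hF.continuous.norm.measurable.mul (by fun_prop)).aestronglyMeasurable
  · rw [Real.norm_of_nonneg (by positivity), ← mul_div_assoc, mul_comm C, mul_div_assoc, mul_comm]
    gcongr
    exact h x

theorem RapidDecay.integrable {F : E → ℂ} (hF : RapidDecay F) : Integrable F := by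
  have hn : 0 < Module.finrank ℝ E := Module.finrank_pos
  have h := hF.integrable_mul_norm_rpow (w := 0) (by simpa using hn)
  refine (integrable_norm_iff hF.continuous.aestronglyMeasurable).mp ?_
  simpa using h

end

theorem ae_ne_zero_E3 : ∀ᵐ x : E3, x ≠ 0 := compl_mem_ae_iff.mpr (measure_singleton (0 : E3))

theorem aestronglyMeasurable_of_continuousOn_compl_zero {f : E3 → ℂ} (hf : ContinuousOn f {0}ᶜ) :
    AEStronglyMeasurable f := by
  have h := hf.aestronglyMeasurable (μ := volume) (measurableSet_singleton (0 : E3)).compl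
  rwa [Measure.restrict_eq_self_of_ae_mem] at h
  exact ae_ne_zero_E3

theorem continuousOn_homogeneous (z : ℂ) {Θ : S2 → ℂ} (hΘ : Continuous Θ) :
    ContinuousOn (homogeneous z Θ) {0}ᶜ := by
  refine ContinuousOn.mul ?_ (continuousOn_comp_angle hΘ)
  intro x hx
  refine (ContinuousAt.cpow (by fun_prop) continuousAt_const ?_).continuousWithinAt
  exact Complex.ofReal_mem_slitPlane.mpr (norm_pos_iff.mpr hx)

theorem exists_integrable_homogeneous {z : ℂ} (hz : -3 < z.re) {Θ : S2 → ℂ} (hΘ : Continuous Θ) :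
    ∃ k : ℕ, Integrable (fun x : E3 => homogeneous z Θ x / ((1 + ‖x‖ : ℝ) : ℂ) ^ k) := by
  obtain ⟨k, hk⟩ := exists_integrable_norm_rpow (E := E3) (w := z.re) (by rw [finrank_E3]; exact_mod_cast hz)
  obtain ⟨C, hC⟩ := isCompact_univ.exists_bound_of_continuousOn hΘ.continuousOn
  refine ⟨k, Integrable.mono' (hk.mul_const C) ?_ ?_⟩
  · refine (aestronglyMeasurable_of_continuousOn_compl_zero (continuousOn_homogeneous z hΘ)).mul
      (Continuous.aestronglyMeasurable ?_)
    refine Continuous.inv₀ (by fun_prop) fun x => ?_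
    have : (1 + ‖x‖ : ℝ) ≠ 0 := by positivity
    exact pow_ne_zero _ (by exact_mod_cast this)
  · filter_upwards [ae_ne_zero_E3] with x hx
    rw [homogeneous, norm_div, norm_pow, Complex.norm_real, Real.norm_of_nonneg (by positivity),
      norm_mul, Complex.norm_cpow_eq_rpow_re_of_pos (norm_pos_iff.mpr hx), div_mul_eq_mul_div]
    gcongr
    exact hC _ (mem_univ _)

section tempered
variable {f : E3 → ℂ} {k : ℕ} (hf : Integrable (fun x : E3 => f x / ((1 + ‖x‖ : ℝ) : ℂ) ^ k))

theorem one_add_norm_pow_ne_zero (x : E3) (k : ℕ) : ((1 + ‖x‖ : ℝ) : ℂ) ^ k ≠ 0 := by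
  have : (1 + ‖x‖ : ℝ) ≠ 0 := by positivity
  exact pow_ne_zero _ (by exact_mod_cast this)

theorem norm_schwartz_mul_le (f : E3 → ℂ) (k : ℕ) (φ : 𝓢(E3, ℂ)) {C : ℝ}
    (hC : ∀ x, ‖φ x‖ ≤ C / (1 + ‖x‖) ^ k) (x : E3) :
    ‖φ x * f x‖ ≤ C * ‖f x / ((1 + ‖x‖ : ℝ) : ℂ) ^ k‖ := by
  rw [norm_mul, norm_div, norm_pow, Complex.norm_real, Real.norm_of_nonneg (by positivity),
    ← mul_div_assoc, mul_comm C, mul_div_assoc, mul_comm]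
  gcongr
  exact hC x

include hf

theorem locallyIntegrable_of_integrable_div_pow : LocallyIntegrable f := by
  have h := hf.locallyIntegrable.locallyIntegrableOn univ
  have h2 := h.continuousOn_mul (g := fun x : E3 => ((1 + ‖x‖ : ℝ) : ℂ) ^ k)
    (Continuous.continuousOn (by fun_prop)) isOpen_univ.isLocallyClosed
  rw [locallyIntegrableOn_univ] at h2
  refine h2.congr (Eventually.of_forall fun x => ?_)
  exact mul_div_cancel₀ _ (one_add_norm_pow_ne_zero x k)

theorem integrable_schwartz_mul (φ : 𝓢(E3, ℂ)) : Integrable (fun x => φ x * f x) := by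
  obtain ⟨C, hC, h⟩ := φ.rapidDecay.bound k
  refine (hf.norm.const_mul C).mono' ?_ (Eventually.of_forall (norm_schwartz_mul_le f k φ h))
  exact φ.continuous.aestronglyMeasurable.mul
    (locallyIntegrable_of_integrable_div_pow hf).aestronglyMeasurable

theorem exists_isGivenBy : ∃ T : 𝓢'(E3, ℂ), IsGivenBy T f := by
  let A : 𝓢(E3, ℂ) →L[ℂ] ℂ := SchwartzMap.mkCLMtoNormedSpace (fun φ => ∫ x, φ x * f x)
    (fun φ χ => by
      rw [← integral_add (integrable_schwartz_mul hf φ) (integrable_schwartz_mul hf χ)]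
      simp [add_mul])
    (fun a φ => by
      simp only [smul_apply, smul_eq_mul, mul_assoc, integral_const_mul,
        RingHom.id_apply])
    ⟨Finset.Iic (k, 0), 2 ^ k * ∫ x, ‖f x / ((1 + ‖x‖ : ℝ) : ℂ) ^ k‖, by positivity, fun φ => by
      have h : ∀ x, ‖φ x‖ ≤ (2 ^ k * ((Finset.Iic (k, 0)).sup
          (schwartzSeminormFamily ℂ E3 ℂ)) φ) / (1 + ‖x‖) ^ k := fun x => by
        rw [le_div_iff₀' (by positivity)]
        simpa using! SchwartzMap.one_add_le_sup_seminorm_apply (𝕜 := ℂ) (m := (k, 0)) (k := k)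
          (n := 0) le_rfl le_rfl φ x
      refine (norm_integral_le_of_norm_le (hf.norm.const_mul _)
        (Eventually.of_forall (norm_schwartz_mul_le f k φ h))).trans_eq ?_
      rw [integral_const_mul]
      ring⟩
  refine ⟨ContinuousLinearMap.toPointwiseConvergenceCLM _ _ _ _ A,
    locallyIntegrable_of_integrable_div_pow hf, fun φ => ⟨integrable_schwartz_mul hf φ, rfl⟩⟩

end tempered

theorem hasFourierTransform_homogeneous {z z' : ℂ} (hz : -3 < z.re) (hz' : -3 < z'.re)
    {Θ Θ' : S2 → ℂ} (hΘ : Continuous Θ) (hΘ' : Continuous Θ')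
    (h : ∀ φ : 𝓢(E3, ℂ), ∫ x, 𝓕 φ x * homogeneous z Θ x = ∫ x, φ x * homogeneous z' Θ' x) :
    HasFourierTransform (homogeneous z Θ) (homogeneous z' Θ') := by
  obtain ⟨k, hk⟩ := exists_integrable_homogeneous hz hΘ
  obtain ⟨k', hk'⟩ := exists_integrable_homogeneous hz' hΘ'
  obtain ⟨T, hT⟩ := exists_isGivenBy hk
  refine ⟨T, hT, locallyIntegrable_of_integrable_div_pow hk', fun φ =>
    ⟨integrable_schwartz_mul hk' φ, ?_⟩⟩
  rw [TemperedDistribution.fourier_apply, (hT.2 _).2, h]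

/-! ### Fourier duality for Mellin transforms along rays -/

/-- The absolute integral along a ray scales exactly like the Mellin integral: substituting `t‖x‖`
for `t` extracts `‖x‖^(-Re z)`. This bound justifies every later exchange of a ray integral with
another integral. -/
theorem exists_integral_norm_ray_le {E : Type*} [NormedAddCommGroup E] [NormedSpace ℝ E]
    {F : E → ℂ} (hF : RapidDecay F) {z : ℂ} (hz : 0 < z.re) : ∃ C : ℝ,
    ∀ x : E, x ≠ 0 → ∫ t in Ioi (0 : ℝ), ‖(t : ℂ) ^ (z - 1) * F (t • x)‖ ≤ C * ‖x‖ ^ (-z.re) := by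
  obtain ⟨k, hk, -⟩ := exists_integrable_mellin_kernel hz
  obtain ⟨C, hC, h⟩ := hF.bound k
  set κ : ℝ → ℝ := fun t => ‖(t : ℂ) ^ (z - 1) / ((1 + t : ℝ) : ℂ) ^ k‖ with hκ
  have hκ' : ∀ t : ℝ, 0 < t → κ t = t ^ (z.re - 1) / (1 + t) ^ k := fun t ht => by
    rw [hκ]
    beta_reduce
    rw [norm_div, norm_pow, Complex.norm_real, Real.norm_of_nonneg (by positivity),
      Complex.norm_cpow_eq_rpow_re_of_pos ht, Complex.sub_re, Complex.one_re]
  refine ⟨C * ∫ t in Ioi (0 : ℝ), κ t, fun x hx => ?_⟩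
  have hr : 0 < ‖x‖ := norm_pos_iff.mpr hx
  have hint : IntegrableOn (fun t => κ (t * ‖x‖)) (Ioi 0) := by
    rw [integrableOn_Ioi_comp_mul_right_iff _ _ hr, zero_mul]
    exact hk.norm
  calc ∫ t in Ioi (0 : ℝ), ‖(t : ℂ) ^ (z - 1) * F (t • x)‖
      ≤ ∫ t in Ioi (0 : ℝ), (C * ‖x‖ ^ (1 - z.re)) * κ (t * ‖x‖) := by
        refine setIntegral_mono_on ?_ (hint.const_mul _) measurableSet_Ioi fun t ht => ?_
        · simpa using! (hF.mellinConvergent_ray hx hz).norm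
        · rw [mem_Ioi] at ht
          have h2 := h (t • x)
          rw [norm_smul, Real.norm_of_nonneg ht.le] at h2
          rw [hκ' _ (by positivity), norm_mul, Complex.norm_cpow_eq_rpow_re_of_pos ht,
            Complex.sub_re, Complex.one_re, Real.mul_rpow ht.le hr.le]
          have h3 : ‖x‖ ^ (1 - z.re) * ‖x‖ ^ (z.re - 1) = 1 := by
            rw [← Real.rpow_add hr]
            simp
          calc t ^ (z.re - 1) * ‖F (t • x)‖ ≤ t ^ (z.re - 1) * (C / (1 + t * ‖x‖) ^ k) := by gcongr
            _ = (‖x‖ ^ (1 - z.re) * ‖x‖ ^ (z.re - 1)) *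
                (t ^ (z.re - 1) * (C / (1 + t * ‖x‖) ^ k)) := by rw [h3, one_mul]
            _ = _ := by ring
    _ = (C * ∫ t in Ioi (0 : ℝ), κ t) * ‖x‖ ^ (-z.re) := by
        rw [integral_const_mul, integral_comp_mul_right_Ioi _ _ hr, zero_mul, smul_eq_mul,
          sub_eq_add_neg, Real.rpow_add hr, Real.rpow_one]
        field_simp

section ray
variable {E : Type*} [NormedAddCommGroup E] [InnerProductSpace ℝ E] [FiniteDimensional ℝ E]
  [Nontrivial E] [MeasurableSpace E] [BorelSpace E]

theorem mellin_ray_eq (F : E3 → ℂ) {x : E3} (hx : x ≠ 0) (z : ℂ) :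
    mellin (fun t : ℝ => F (t • x)) z =
      (‖x‖ : ℂ) ^ (-z) * mellin (fun t : ℝ => F (t • (angle x : E3))) z := by
  rw [← smul_eq_mul, ← mellin_comp_mul_right _ _ (norm_pos_iff.mpr hx)]
  congr 1 with t
  rw [mul_smul, norm_smul_angle hx]

/-- Fubini. The inner absolute integral is at most a multiple of `‖x‖^(-Re z)`, which is integrable
against the rapidly decaying `F₁` because `Re z` is below the dimension. -/
theorem integral_mul_mellin_ray {F₁ F₂ : E → ℂ} (h₁ : RapidDecay F₁)
    (h₂ : RapidDecay F₂) {z : ℂ} (hz : 0 < z.re) (hz' : z.re < Module.finrank ℝ E) :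
    ∫ x, F₁ x * mellin (fun t : ℝ => F₂ (t • x)) z = mellin (fun t : ℝ => ∫ x, F₁ x * F₂ (t • x)) z := by
  have hmeas : AEStronglyMeasurable
      (fun p : E × ℝ => F₁ p.1 * ((p.2 : ℂ) ^ (z - 1) * F₂ (p.2 • p.1)))
      ((volume : Measure E).prod (volume.restrict (Ioi 0))) := by
    refine Measurable.aestronglyMeasurable ?_
    have h2 : Measurable (fun p : E × ℝ => F₂ (p.2 • p.1)) :=
      (h₂.continuous.comp (by fun_prop)).measurable
    have h3 : Measurable (fun p : E × ℝ => (p.2 : ℂ) ^ (z - 1)) := by fun_prop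
    exact (h₁.continuous.measurable.comp measurable_fst).mul (h3.mul h2)
  have hint : Integrable (fun p : E × ℝ => F₁ p.1 * ((p.2 : ℂ) ^ (z - 1) * F₂ (p.2 • p.1)))
      ((volume : Measure E).prod (volume.restrict (Ioi 0))) := by
    rw [integrable_prod_iff hmeas]
    constructor
    · filter_upwards [Measure.ae_ne volume (0 : E)] with x hx
      exact Integrable.const_mul (h₂.mellinConvergent_ray hx hz) (F₁ x)
    · obtain ⟨C, hC⟩ := exists_integral_norm_ray_le h₂ hz
      refine ((h₁.integrable_mul_norm_rpow (w := -z.re) (by linarith)).const_mul C).mono'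
        hmeas.norm.integral_prod_right' ?_
      filter_upwards [Measure.ae_ne volume (0 : E)] with x hx
      rw [Real.norm_of_nonneg (integral_nonneg fun _ => norm_nonneg _)]
      simp_rw [norm_mul (F₁ x)]
      rw [integral_const_mul, mul_left_comm]
      gcongr
      exact hC x hx
  calc ∫ x, F₁ x * mellin (fun t : ℝ => F₂ (t • x)) z
      = ∫ x, ∫ t in Ioi (0 : ℝ), F₁ x * ((t : ℂ) ^ (z - 1) * F₂ (t • x)) := by
        congr 1 with x
        rw [integral_const_mul]
        rfl
    _ = ∫ t in Ioi (0 : ℝ), ∫ x, F₁ x * ((t : ℂ) ^ (z - 1) * F₂ (t • x)) :=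
        integral_integral_swap hint
    _ = _ := by
        rw [mellin]
        congr 1 with t
        rw [smul_eq_mul, ← integral_const_mul]
        congr 1 with x
        ring

omit [Nontrivial E] in
theorem integral_fourier_mul_comp_smul {φ G : E → ℂ} (hφ : Integrable φ) (hG : Integrable G) {t : ℝ}
    (ht : 0 < t) :
    ∫ x, 𝓕 φ x * G (t • x) =
      (t : ℂ) ^ (-Module.finrank ℝ E : ℂ) * ∫ ξ, φ ξ * 𝓕 G (t⁻¹ • ξ) := by
  have h1 : ∀ ξ : E, 𝓕 (fun x : E => G (t • x)) ξ =
      (t : ℂ) ^ (-Module.finrank ℝ E : ℂ) * 𝓕 G (t⁻¹ • ξ) := by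
    intro ξ
    rw [Real.fourier_eq, Real.fourier_eq]
    have h2 := Measure.integral_comp_smul (volume : Measure E)
      (fun x => Real.fourierChar (-inner ℝ x (t⁻¹ • ξ)) • G x) t
    have h3 : (t : ℂ) ^ (-Module.finrank ℝ E : ℂ) = ((|(t ^ Module.finrank ℝ E)⁻¹| : ℝ) : ℂ) := by
      rw [abs_of_pos (by positivity), Complex.cpow_neg, Complex.cpow_natCast]
      norm_cast
    rw [h3, ← Complex.real_smul, ← h2]
    congr 1 with x
    rw [inner_smul_left, inner_smul_right]
    simp [ht.ne']
  have hGi : Integrable (fun x : E => G (t • x)) := hG.comp_smul ht.ne'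
  have h4 := VectorFourier.integral_fourierIntegral_smul_eq_flip (μ := (volume : Measure E))
    (ν := (volume : Measure E)) (L := innerₗ E) Real.continuous_fourierChar continuous_inner
    hφ hGi
  rw [flip_innerₗ] at h4
  rw [← integral_const_mul]
  refine h4.trans ?_
  congr 1 with ξ
  rw [smul_eq_mul, ← mul_left_comm, ← h1 ξ]
  rfl

/-- Moving the Fourier transform onto each dilate of `G` gives `t^(-n) 𝓕G(·/t)`; the substitution `t
↦ 1/t` then turns the exponent `s` into `n - s`. The dimension is left free because the identity
serves twice: in dimension three for the main transform, and on the line against the Gaussian. -/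
theorem integral_fourier_mul_mellin_ray {φ G : E → ℂ} (hφ : RapidDecay φ) (hφ' : RapidDecay (𝓕 φ))
    (hG : RapidDecay G) (hG' : RapidDecay (𝓕 G)) {s : ℂ} (hs : 0 < s.re)
    (hs' : s.re < Module.finrank ℝ E) :
    ∫ x, 𝓕 φ x * mellin (fun t : ℝ => G (t • x)) s =
      ∫ ξ, φ ξ * mellin (fun t : ℝ => 𝓕 G (t • ξ)) (Module.finrank ℝ E - s) := by
  rw [integral_mul_mellin_ray hφ' hG hs hs', integral_mul_mellin_ray hφ hG'
    (by simpa using hs') (by simpa using hs)]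
  have h : ∀ t ∈ Ioi (0 : ℝ), (t : ℂ) ^ (s - 1) • (∫ x, 𝓕 φ x * G (t • x)) =
      (t : ℂ) ^ (s - 1) • ((t : ℂ) ^ (-Module.finrank ℝ E : ℂ) •
        (fun u : ℝ => ∫ ξ, φ ξ * 𝓕 G (u • ξ)) t⁻¹) :=
    fun t ht => by
      rw [integral_fourier_mul_comp_smul hφ.integrable hG.integrable ht, smul_eq_mul (a := _ ^ _)]
      rfl
  have h' := setIntegral_congr_fun (μ := volume) measurableSet_Ioi h
  refine h'.trans ?_
  change mellin (fun t : ℝ => (t : ℂ) ^ (-Module.finrank ℝ E : ℂ) •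
    (fun u : ℝ => ∫ ξ, φ ξ * 𝓕 G (u • ξ)) t⁻¹) s = _
  rw [mellin_cpow_smul, mellin_comp_inv (fun u : ℝ => ∫ ξ, φ ξ * 𝓕 G (u • ξ))]
  congr 1
  ring

end ray

/-! ### The angular function: duality, smoothness and holomorphy -/

section
variable {ψ : ℝ → ℂ} (hψ : IsProfile ψ) {Θ : S2 → ℂ} (hΘ : ContMDiff (𝓡 2) 𝓘(ℝ, ℂ) ∞ Θ)

/-- Integrating over dilations removes the radial profile and leaves only its Mellin transform as a
scalar factor. -/
theorem mellin_polarProduct (ψ : ℝ → ℂ) (Θ : S2 → ℂ) {x : E3} (hx : x ≠ 0) (s : ℂ) :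
    mellin (fun t : ℝ => polarProduct ψ Θ (t • x)) s = mellin ψ s * homogeneous (-s) Θ x := by
  rw [mellin_ray_eq _ hx, homogeneous, mul_left_comm]
  congr 1
  rw [mul_comm, ← smul_eq_mul, ← mellin_const_smul]
  refine setIntegral_congr_fun measurableSet_Ioi fun t ht => ?_
  simp only [polarProduct_smul_coe ψ Θ ht, smul_eq_mul]
  ring

/-- The angular function of the Fourier transform of `mellin ψ s * |x|^{-s} Θ(x̄)`. -/
noncomputable def fourierAngular (hψ : IsProfile ψ) (hΘ : ContMDiff (𝓡 2) 𝓘(ℝ, ℂ) ∞ Θ) (ξ : S2)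
    (s : ℂ) : ℂ :=
  mellin (fun t : ℝ => 𝓕 (polarSchwartz hψ hΘ) (t • (ξ : E3))) (3 - s)

theorem integral_fourier_mul_homogeneous (φ : 𝓢(E3, ℂ)) {s : ℂ} (hs : s ∈ strip) :
    mellin ψ s * ∫ x, 𝓕 φ x * homogeneous (-s) Θ x =
      ∫ ξ, φ ξ * homogeneous (s - 3) (fun ξ => fourierAngular hψ hΘ ξ s) ξ := by
  have h := integral_fourier_mul_mellin_ray φ.rapidDecay (𝓕 φ).rapidDecay
    (polarSchwartz hψ hΘ).rapidDecay (𝓕 (polarSchwartz hψ hΘ)).rapidDecay hs.1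
    (by rw [finrank_E3]; exact_mod_cast hs.2)
  rw [finrank_E3, Nat.cast_ofNat] at h
  rw [← integral_const_mul]
  refine Eq.trans ?_ (h.trans ?_)
  · refine integral_congr_ae ?_
    filter_upwards [ae_ne_zero_E3] with x hx
    simp only [polarSchwartz_apply]
    rw [mellin_polarProduct ψ Θ hx, SchwartzMap.fourier_coe]
    ring
  · refine integral_congr_ae ?_
    filter_upwards [ae_ne_zero_E3] with x hx
    rw [mellin_ray_eq _ hx, homogeneous, fourierAngular, neg_sub, SchwartzMap.fourier_coe]

theorem contMDiff_fourierAngular {s : ℂ} (hs : s.re < 3) :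
    ContMDiff (𝓡 2) 𝓘(ℝ, ℂ) ∞ (fun ξ => fourierAngular hψ hΘ ξ s) :=
  (contDiffOn_mellin_ray (𝓕 (polarSchwartz hψ hΘ))
    (by simpa using hs : 0 < (3 - s).re)).1.contMDiff_restrict_sphere

theorem hasDerivAt_fourierAngular (ξ : S2) {s : ℂ} (hs : s.re < 3) :
    HasDerivAt (fourierAngular hψ hΘ ξ) (-mellin (fun t : ℝ => Real.log t •
      𝓕 (polarSchwartz hψ hΘ) (t • (ξ : E3))) (3 - s)) s := by
  have h := ((𝓕 (polarSchwartz hψ hΘ)).rapidDecay.hasDerivAt_mellin_ray (coe_S2_ne_zero ξ)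
    (by simpa using hs : 0 < (3 - s).re)).2
  simpa using! h.comp s ((hasDerivAt_id s).const_sub 3)

theorem contMDiff_deriv_fourierAngular {s : ℂ} (hs : s.re < 3) :
    ContMDiff (𝓡 2) 𝓘(ℝ, ℂ) ∞ (fun ξ => deriv (fourierAngular hψ hΘ ξ) s) := by
  simp_rw [fun ξ => (hasDerivAt_fourierAngular hψ hΘ ξ hs).deriv]
  exact ((contDiffOn_mellin_ray (𝓕 (polarSchwartz hψ hΘ))
    (by simpa using hs : 0 < (3 - s).re)).2.neg).contMDiff_restrict_sphere

end

/-! ### The Gaussian and the Mellin transform of the cosine transform -/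

/-- The Gaussian `exp (-π x²)`. -/
noncomputable def stdGaussian (x : ℝ) : ℂ := Complex.exp (-π * (x : ℂ) ^ 2)

theorem norm_stdGaussian (x : ℝ) : ‖stdGaussian x‖ = Real.exp (-π * x ^ 2) := by
  rw [stdGaussian, Complex.norm_exp]
  congr 1
  norm_cast

theorem rapidDecay_stdGaussian : RapidDecay stdGaussian := by
  refine ⟨by unfold stdGaussian; fun_prop, fun k => ⟨k.factorial * Real.exp 2, by positivity,
    fun x => ?_⟩⟩
  rw [norm_stdGaussian, le_div_iff₀ (by positivity)]
  have h1 := Real.pow_div_factorial_le_exp (1 + ‖x‖) (by positivity) k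
  rw [div_le_iff₀ (by positivity)] at h1
  calc Real.exp (-π * x ^ 2) * (1 + ‖x‖) ^ k
      ≤ Real.exp (-π * x ^ 2) * (Real.exp (1 + ‖x‖) * k.factorial) := by gcongr
    _ = k.factorial * Real.exp (-π * x ^ 2 + (1 + ‖x‖)) := by
        rw [Real.exp_add _ (1 + ‖x‖)]; ring
    _ ≤ k.factorial * Real.exp 2 := by
        gcongr
        rw [← sq_abs, Real.norm_eq_abs]
        nlinarith [Real.pi_gt_three, sq_nonneg (|x| - 1), sq_nonneg |x|]

theorem fourier_stdGaussian : 𝓕 stdGaussian = stdGaussian := by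
  have h := fourier_gaussian_pi (b := 1) (by simp)
  have e : stdGaussian = fun x : ℝ => Complex.exp (-(↑π * ↑x ^ 2)) := by
    funext x
    simp [stdGaussian]
  rw [e]
  simpa using h

/-- The substitution `u = t²` reduces this to the Gamma integral at `z / 2`. -/
theorem mellin_stdGaussian {z : ℂ} (hz : 0 < z.re) :
    mellin stdGaussian z = Complex.Gammaℝ z / 2 := by
  have h1 : mellin stdGaussian z =
      mellin (fun t : ℝ => (fun u : ℝ => Complex.exp (-(π * u))) (t ^ (2 : ℝ))) z := by
    congr 1 with t
    simp [stdGaussian]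
  have h2 : mellin (fun u : ℝ => Complex.exp (-((π : ℝ) * u))) (z / 2) =
      (1 / (π : ℝ)) ^ (z / 2) * Complex.Gamma (z / 2) := by
    rw [← Complex.integral_cpow_mul_exp_neg_mul_Ioi (by simpa using hz) Real.pi_pos]
    rfl
  rw [h1, mellin_comp_rpow (fun u : ℝ => Complex.exp (-(π * u))), Complex.ofReal_ofNat, h2, Complex.Gammaℝ_def, one_div,
    Complex.inv_cpow _ _ (by rw [Complex.arg_ofReal_of_nonneg Real.pi_pos.le]; exact Real.pi_pos.ne),
    ← Complex.cpow_neg, neg_div]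
  simp
  ring

theorem mellin_stdGaussian_ray {z : ℂ} (hz : 0 < z.re) {x : ℝ} (hx : x ≠ 0) :
    mellin (fun t : ℝ => stdGaussian (t • x)) z = ((|x| : ℝ) : ℂ) ^ (-z) * (Complex.Gammaℝ z / 2) := by
  rw [← mellin_stdGaussian hz, ← smul_eq_mul, ← mellin_comp_mul_right _ _ (abs_pos.mpr hx)]
  congr 1 with t
  rw [stdGaussian, stdGaussian, ← Complex.ofReal_pow, ← Complex.ofReal_pow, smul_eq_mul, mul_pow,
    mul_pow, sq_abs]

theorem mellin_add_comp_neg {f : ℝ → ℂ} {a : ℂ} (h : MellinConvergent f a)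
    (h' : MellinConvergent (fun t => f (-t)) a) :
    mellin (fun t => f t + f (-t)) a = ∫ x : ℝ, f x * ((|x| : ℝ) : ℂ) ^ (a - 1) := by
  have e1 : EqOn (fun t : ℝ => (t : ℂ) ^ (a - 1) • f t) (fun x : ℝ => f x * ((|x| : ℝ) : ℂ) ^ (a - 1))
      (Ioi 0) := fun t ht => by
    simp only [smul_eq_mul, mul_comm]
    rw [abs_of_pos ht]
  have e2 : EqOn (fun t : ℝ => (t : ℂ) ^ (a - 1) • f (-t))
      (fun x : ℝ => f (-x) * ((|-x| : ℝ) : ℂ) ^ (a - 1)) (Ioi 0) := fun t ht => by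
    simp only [smul_eq_mul, mul_comm]
    rw [abs_neg, abs_of_pos ht]
  have i1 : IntegrableOn (fun x : ℝ => f x * ((|x| : ℝ) : ℂ) ^ (a - 1)) (Ioi 0) :=
    h.congr_fun e1 measurableSet_Ioi
  have i2 : IntegrableOn (fun x : ℝ => f (-x) * ((|-x| : ℝ) : ℂ) ^ (a - 1)) (Ioi 0) :=
    h'.congr_fun e2 measurableSet_Ioi
  have i3 : IntegrableOn (fun x : ℝ => f x * ((|x| : ℝ) : ℂ) ^ (a - 1)) (Iic 0) := by
    rw [integrableOn_Iic_iff_integrableOn_Iio]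
    have e3 := (Measure.measurePreserving_neg (volume : Measure ℝ)).integrableOn_comp_preimage
      (Homeomorph.neg ℝ).measurableEmbedding
      (f := fun x : ℝ => f x * ((|x| : ℝ) : ℂ) ^ (a - 1)) (s := Iio 0)
    refine e3.mp ?_
    simpa [Function.comp_def] using i2
  rw [(hasMellin_add h h').2, ← intervalIntegral.integral_Iic_add_Ioi i3 i1, add_comm]
  congr 1
  · have := integral_comp_neg_Ioi 0 (fun x : ℝ => f x * ((|x| : ℝ) : ℂ) ^ (a - 1))
    rw [neg_zero] at this
    rw [← this]
    exact setIntegral_congr_fun measurableSet_Ioi e2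
  · exact setIntegral_congr_fun measurableSet_Ioi e1

/-- The reflection formula rewrites the ratio as `Gammaℂ a * cos (π a / 2)`, and `Gammaℂ a` is `2
(2π)^(-a) Γ(a)`. -/
theorem Gammaℝ_div_Gammaℝ_one_sub {a : ℝ} (ha : 0 < a) :
    Complex.Gammaℝ a * (Complex.Gammaℝ (1 - a))⁻¹ = 2 * tau a := by
  have h0 : Complex.Gammaℝ a ≠ 0 := Complex.Gammaℝ_ne_zero_of_re_pos (by simpa using ha)
  rw [Complex.inv_Gammaℝ_one_sub, Complex.Gammaℂ_def, tau]
  · push_cast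
    rw [Complex.ofReal_cpow (by positivity), ← Complex.Gamma_ofReal]
    push_cast
    field_simp
  · intro n hn
    have := congrArg Complex.re hn
    simp at this
    have : (0 : ℝ) ≤ n := Nat.cast_nonneg n
    linarith

namespace IsProfile

variable {χ : ℝ → ℂ} (hχ : IsProfile χ)
include hχ

theorem rapidDecay : RapidDecay χ :=
  (hχ.compact.toSchwartzMap hχ.contDiff).rapidDecay

theorem rapidDecay_fourier : RapidDecay (𝓕 χ) :=
  (𝓕 (hχ.compact.toSchwartzMap hχ.contDiff)).rapidDecay

theorem mellinConvergent_fourier {a : ℂ} (ha : 0 < a.re) :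
    MellinConvergent (𝓕 χ) a ∧ MellinConvergent (fun t => 𝓕 χ (-t)) a := by
  have h1 := hχ.rapidDecay_fourier.mellinConvergent_ray one_ne_zero ha
  have h2 := hχ.rapidDecay_fourier.mellinConvergent_ray (neg_ne_zero.mpr one_ne_zero) ha
  simp only [smul_eq_mul, mul_one, mul_neg] at h1 h2
  exact ⟨h1, h2⟩

/-- The Mellin transform of the cosine transform of a profile. -/
theorem mellin_fourier_add_comp_neg {a : ℝ} (ha : 0 < a) (ha' : a < 1) :
    mellin (fun t => 𝓕 χ t + 𝓕 χ (-t)) a = 2 * tau a * mellin χ (1 - a) := by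
  have hre : (1 - (a : ℂ)).re = 1 - a := by simp
  have ha0 : 0 < (a : ℂ).re := by simpa using ha
  -- The Gaussian is its own Fourier transform, and its ray integral of exponent `z` is `|x|^(-z) *
  -- Gammaℝ z / 2`. Testing against it thus compares the two Mellin transforms with explicit Gamma
  -- factors.
  have h := integral_fourier_mul_mellin_ray hχ.rapidDecay hχ.rapidDecay_fourier
    rapidDecay_stdGaussian (by rw [fourier_stdGaussian]; exact rapidDecay_stdGaussian)
    (s := 1 - (a : ℂ)) (by rw [hre]; linarith) (by rw [hre]; simpa using ha)
  rw [fourier_stdGaussian, Module.finrank_self, Nat.cast_one, sub_sub_cancel] at h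
  have h1 : ∫ x, 𝓕 χ x * mellin (fun t : ℝ => stdGaussian (t • x)) (1 - a) =
      Complex.Gammaℝ (1 - a) / 2 * mellin (fun t => 𝓕 χ t + 𝓕 χ (-t)) a := by
    rw [mellin_add_comp_neg (hχ.mellinConvergent_fourier ha0).1 (hχ.mellinConvergent_fourier ha0).2,
      ← integral_const_mul]
    refine integral_congr_ae ?_
    filter_upwards [Measure.ae_ne volume (0 : ℝ)] with x hx
    rw [mellin_stdGaussian_ray (by rw [hre]; linarith) hx, neg_sub]
    ring
  have h2 : ∫ x, χ x * mellin (fun t : ℝ => stdGaussian (t • x)) a =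
      Complex.Gammaℝ a / 2 * mellin χ (1 - a) := by
    have h3 : mellin χ (1 - a) = ∫ x in Ioi (0 : ℝ), χ x * ((|x| : ℝ) : ℂ) ^ (-(a : ℂ)) := by
      refine setIntegral_congr_fun measurableSet_Ioi fun t ht => ?_
      rw [mem_Ioi] at ht
      simp only [smul_eq_mul, mul_comm, abs_of_pos ht]
      ring_nf
    have h4 : Function.support (fun x => χ x * ((|x| : ℝ) : ℂ) ^ (-(a : ℂ))) ⊆ Ioi 0 := fun x hx => by
      by_contra h0
      exact hx (by simp [hχ.eq_zero_of_nonpos (not_lt.mp h0)])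
    rw [h3, setIntegral_eq_integral_of_forall_compl_eq_zero
      (fun x hx => by by_contra h0; exact hx (h4 h0)), ← integral_const_mul]
    refine integral_congr_ae ?_
    filter_upwards [Measure.ae_ne volume (0 : ℝ)] with x hx
    rw [mellin_stdGaussian_ray ha0 hx]
    ring
  rw [h1, h2] at h
  have hne : Complex.Gammaℝ (1 - a) ≠ 0 :=
    Complex.Gammaℝ_ne_zero_of_re_pos (by rw [hre]; linarith)
  rw [← Gammaℝ_div_Gammaℝ_one_sub ha]
  field_simp
  linear_combination 2 * h

end IsProfile

/-! ### Polar and orthonormal coordinates -/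

/-- The radial measure `r² dr` on `(0, ∞)`. -/
noncomputable def radialMeasure : Measure ℝ :=
  (volume.restrict (Ioi 0)).withDensity fun r => ENNReal.ofReal (r ^ 2)

theorem map_volumeIoiPow :
    (Measure.volumeIoiPow 2).map (Subtype.val : Ioi (0 : ℝ) → ℝ) = radialMeasure := by
  ext s hs
  rw [Measure.map_apply measurable_subtype_coe hs, Measure.volumeIoiPow, radialMeasure,
    withDensity_apply _ (measurable_subtype_coe hs), withDensity_apply _ hs,
    ← lintegral_indicator (measurable_subtype_coe hs), ← lintegral_indicator hs]
  have h := lintegral_subtype_comap (μ := volume) (measurableSet_Ioi (a := (0 : ℝ)))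
    (s.indicator fun r : ℝ => ENNReal.ofReal (r ^ 2))
  rw [← h]
  rfl

instance sFinite_radialMeasure : SFinite radialMeasure := by
  rw [radialMeasure]
  infer_instance

instance isFiniteMeasure_surfaceMeasure : IsFiniteMeasure surfaceMeasure := by
  unfold surfaceMeasure; infer_instance

theorem measurePreserving_polar :
    MeasurePreserving (fun p : S2 × ℝ => p.2 • (p.1 : E3)) (surfaceMeasure.prod radialMeasure)
      volume := by
  have h0 := Measure.measurePreserving_homeomorphUnitSphereProd (volume : Measure E3)
  rw [finrank_E3] at h0
  have h1 := MeasurePreserving.symm (homeomorphUnitSphereProd E3).toMeasurableEquiv h0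
  have h2 : MeasurePreserving (Subtype.val : ({0}ᶜ : Set E3) → E3)
      ((volume : Measure E3).comap Subtype.val) volume := by
    refine ⟨measurable_subtype_coe, ?_⟩
    rw [map_comap_subtype_coe (measurableSet_singleton (0 : E3)).compl,
      restrict_compl_singleton]
  have h3 := h2.comp h1
  have h4 : MeasurePreserving (Subtype.val : Ioi (0 : ℝ) → ℝ) (Measure.volumeIoiPow 2)
    radialMeasure := ⟨measurable_subtype_coe, map_volumeIoiPow⟩
  have h5 := (MeasurePreserving.id surfaceMeasure).prod h4
  refine ⟨by fun_prop, ?_⟩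
  rw [← h5.map_eq, Measure.map_map (by fun_prop) h5.measurable, ← h3.map_eq]
  rfl

theorem surfaceMeasure_prod_radialMeasure :
    surfaceMeasure.prod radialMeasure = (surfaceMeasure.prod (volume.restrict (Ioi 0))).withDensity
      fun p => ENNReal.ofReal (p.2 ^ 2) := by
  rw [radialMeasure, prod_withDensity_right (by fun_prop)]

theorem integrable_polar_iff {f : E3 → ℂ} (hf : AEStronglyMeasurable f) :
    Integrable (fun p : S2 × ℝ => (p.2 ^ 2 : ℝ) • f (p.2 • (p.1 : E3)))
      (surfaceMeasure.prod (volume.restrict (Ioi 0))) ↔ Integrable f := by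
  rw [← measurePreserving_polar.integrable_comp hf, surfaceMeasure_prod_radialMeasure,
    integrable_withDensity_iff_integrable_smul' (by fun_prop) (by simp)]
  simp [ENNReal.toReal_ofReal (sq_nonneg _)]

theorem integral_polar {f : E3 → ℂ} (hf : AEStronglyMeasurable f) :
    ∫ y, f y = ∫ p : S2 × ℝ, (p.2 ^ 2 : ℝ) • f (p.2 • (p.1 : E3))
      ∂(surfaceMeasure.prod (volume.restrict (Ioi 0))) := by
  rw [← measurePreserving_polar.map_eq, integral_map measurePreserving_polar.aemeasurable
    (by rwa [measurePreserving_polar.map_eq]), surfaceMeasure_prod_radialMeasure,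
    integral_withDensity_eq_integral_toReal_smul (by fun_prop) (by simp)]
  simp [ENNReal.toReal_ofReal (sq_nonneg _)]

/-- The orthonormal basis of three-space given by an orthonormal triple. -/
theorem Orthonormal.exists_orthonormalBasis_eq {w : Fin 3 → E3} (h : Orthonormal ℝ w) :
    ∃ b : OrthonormalBasis (Fin 3) ℝ E3, ⇑b = w := by
  have hc : Fintype.card (Fin 3) = Module.finrank ℝ E3 := by simp
  let B := basisOfOrthonormalOfCardEqFinrank h hc
  have hB : ⇑B = w := coe_basisOfOrthonormalOfCardEqFinrank h hc
  exact ⟨B.toOrthonormalBasis (by rw [hB]; exact h), by simp [hB]⟩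

theorem measurePreserving_orthonormal_coordinates {ξ u v : E3} (h : Orthonormal ℝ ![ξ, u, v]) :
    MeasurePreserving (fun p : ℝ × ℝ × ℝ => p.1 • ξ + (p.2.1 • u + p.2.2 • v)) := by
  obtain ⟨b, hb⟩ := h.exists_orthonormalBasis_eq
  have h1 := (volume_preserving_piFinSuccAbove (fun _ : Fin 3 => ℝ) 0).symm
  have h2 := (MeasurePreserving.id (volume : Measure ℝ)).prod
    (volume_preserving_finTwoArrow ℝ).symm
  have h3 := PiLp.volume_preserving_toLp (Fin 3)
  have h4 := b.measurePreserving_repr_symm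
  have h5 := h4.comp (h3.comp (h1.comp h2))
  convert! h5 using 1
  funext p
  have h6 : b.repr.symm (WithLp.toLp 2 ![p.1, p.2.1, p.2.2]) =
      p.1 • ξ + (p.2.1 • u + p.2.2 • v) := by
    rw [← b.sum_repr_symm]
    simp [Fin.sum_univ_three, hb, add_assoc]
  rw [← h6]
  simp only [Function.comp_apply]
  congr 2
  funext i
  fin_cases i <;> rfl

section
variable {ξ u v : E3} (h : Orthonormal ℝ ![ξ, u, v]) (t p q : ℝ)
include h

theorem Orthonormal.inner_coordinates :
    inner ℝ (t • ξ + (p • u + q • v)) ξ = t ∧ inner ℝ (t • ξ + (p • u + q • v)) u = p ∧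
      inner ℝ (t • ξ + (p • u + q • v)) v = q := by
  have ho := orthonormal_iff_ite.mp h
  have e0 : ‖ξ‖ = 1 := h.1 0
  have e1 : ‖u‖ = 1 := h.1 1
  have e2 : ‖v‖ = 1 := h.1 2
  have e01 : inner ℝ ξ u = (0 : ℝ) := by simpa using ho 0 1
  have e02 : inner ℝ ξ v = (0 : ℝ) := by simpa using ho 0 2
  have e12 : inner ℝ u v = (0 : ℝ) := by simpa using ho 1 2
  have e10 : inner ℝ u ξ = (0 : ℝ) := by simpa using ho 1 0
  have e20 : inner ℝ v ξ = (0 : ℝ) := by simpa using ho 2 0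
  have e21 : inner ℝ v u = (0 : ℝ) := by simpa using ho 2 1
  simp [inner_add_left, real_inner_smul_left, e0, e1, e2, e01, e02, e12, e10, e20, e21]

theorem Orthonormal.abs_coordinates_le :
    |t| ≤ ‖t • ξ + (p • u + q • v)‖ ∧ |p| ≤ ‖t • ξ + (p • u + q • v)‖ ∧
      |q| ≤ ‖t • ξ + (p • u + q • v)‖ := by
  obtain ⟨h0, h1, h2⟩ := h.inner_coordinates t p q
  have b : ∀ w : E3, ‖w‖ = 1 → |inner ℝ (t • ξ + (p • u + q • v)) w| ≤
      ‖t • ξ + (p • u + q • v)‖ := fun w hw => by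
    simpa [hw] using abs_real_inner_le_norm (t • ξ + (p • u + q • v)) w
  have b0 := b ξ (h.1 0)
  have b1 := b u (h.1 1)
  have b2 := b v (h.1 2)
  rw [h0] at b0
  rw [h1] at b1
  rw [h2] at b2
  exact ⟨b0, b1, b2⟩

end

section decay
variable {E : Type*} [NormedAddCommGroup E]

theorem RapidDecay.add_comp_neg {F : E → ℂ} (hF : RapidDecay F) :
    RapidDecay (fun x => F x + F (-x)) := by
  refine ⟨hF.continuous.add (hF.continuous.comp continuous_neg), fun k => ?_⟩
  obtain ⟨C, hC, h⟩ := hF.bound k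
  refine ⟨C + C, by positivity, fun x => (norm_add_le _ _).trans ?_⟩
  rw [add_div]
  have h2 := h (-x)
  rw [norm_neg] at h2
  exact add_le_add (h x) h2

theorem RapidDecay.comp_smul_unit [NormedSpace ℝ E] {F : E → ℂ} (hF : RapidDecay F) {ξ : E} (hξ : ‖ξ‖ = 1) :
    RapidDecay (fun t : ℝ => F (t • ξ)) := by
  refine ⟨hF.continuous_ray ξ, fun k => ?_⟩
  obtain ⟨C, hC, h⟩ := hF.bound k
  refine ⟨C, hC, fun t => ?_⟩
  simpa [norm_smul, hξ] using h (t • ξ)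

end decay

/-! ### Integrability of powers of `|x·ξ|` on the sphere -/

theorem ae_radialMeasure_imp {p : ℝ → Prop} (h : ∀ᵐ r ∂radialMeasure, p r) :
    ∀ᵐ r ∂(volume.restrict (Ioi (0 : ℝ))), p r := by
  refine (withDensity_absolutelyContinuous' (μ := volume.restrict (Ioi (0 : ℝ))) (f := fun r : ℝ => ENNReal.ofReal (r ^ 2))
    (by fun_prop) ?_).ae_le h
  filter_upwards [ae_restrict_mem measurableSet_Ioi] with r hr
  simpa using (mem_Ioi.mp hr).ne'

theorem neBot_ae_restrict_Ioi : (ae (volume.restrict (Ioi (0 : ℝ)))).NeBot := by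
  rw [ae_neBot]
  intro h
  have := congrArg (fun μ : Measure ℝ => μ univ) h
  simp at this

/-- The plane orthogonal to `ξ` is null in space. By Fubini in polar coordinates almost every
direction has some positive multiple off the plane, hence is itself off the plane. -/
theorem ae_inner_ne_zero (ξ : S2) : ∀ᵐ x : S2 ∂surfaceMeasure, inner ℝ (x : E3) (ξ : E3) ≠ 0 := by
  have hker : (volume : Measure E3) (LinearMap.ker (innerSL ℝ (ξ : E3)).toLinearMap) = 0 := by
    refine Measure.addHaar_submodule _ _ fun h => ?_
    have h1 : (ξ : E3) ∈ LinearMap.ker (innerSL ℝ (ξ : E3)).toLinearMap := by rw [h]; trivial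
    simp at h1
  have h1 : ∀ᵐ y : E3, inner ℝ y (ξ : E3) ≠ 0 := by
    refine measure_mono_null (fun y hy => ?_) hker
    have hy' : inner ℝ y (ξ : E3) = (0 : ℝ) := by simpa using hy
    simpa [real_inner_comm] using! hy'
  have h2 := Measure.ae_ae_of_ae_prod (measurePreserving_polar.quasiMeasurePreserving.ae h1)
  have := neBot_ae_restrict_Ioi
  filter_upwards [h2] with x hx h0
  obtain ⟨r, hr⟩ := (ae_radialMeasure_imp hx).exists
  exact hr (by rw [real_inner_smul_left, h0, mul_zero])

theorem integrable_abs_rpow_indicator {a : ℝ} (ha : a < 1) :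
    Integrable ((Icc (-1 : ℝ) 1).indicator fun t => |t| ^ (-a)) := by
  rw [integrable_indicator_iff measurableSet_Icc]
  have h := (intervalIntegral.intervalIntegrable_rpow' (a := 0) (b := 1) (r := -a) (by linarith))
  have h1 : IntervalIntegrable (fun t : ℝ => |t| ^ (-a)) volume 0 1 := by
    refine h.congr fun t ht => ?_
    rw [uIoc_of_le zero_le_one] at ht
    simp only [abs_of_pos ht.1]
  have h2 : IntervalIntegrable (fun t : ℝ => |t| ^ (-a)) volume (-1) 0 := by
    have := (IntervalIntegrable.iff_comp_neg (f := fun t : ℝ => |t| ^ (-a))).mp h1.symm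
    simpa using this
  rw [integrableOn_Icc_iff_integrableOn_Ioc]
  exact (intervalIntegrable_iff_integrableOn_Ioc_of_le (by norm_num)).mp (h2.trans h1)

/-- In orthonormal coordinates adapted to `ξ` the ball lies in the cube `[-1, 1]³`, and the
integrand is `|t|^(-a)` in the first coordinate alone. -/
theorem integrable_ball_abs_inner_rpow (ξ : S2) {a : ℝ} (ha : a < 1) :
    Integrable ((Metric.ball (0 : E3) 1).indicator
      fun y => ((|inner ℝ y (ξ : E3)| ^ (-a) : ℝ) : ℂ)) := by
  obtain ⟨⟨u, v⟩, h⟩ := exists_orthonormal_triple ξ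
  have hm : AEStronglyMeasurable ((Metric.ball (0 : E3) 1).indicator
      fun y => ((|inner ℝ y (ξ : E3)| ^ (-a) : ℝ) : ℂ)) := by
    refine (Measurable.indicator ?_ measurableSet_ball).aestronglyMeasurable
    fun_prop
  rw [← (measurePreserving_orthonormal_coordinates h).integrable_comp hm]
  have h1 : Integrable ((Icc (-1 : ℝ) 1).indicator fun _ => (1 : ℝ)) :=
    (integrable_indicator_iff measurableSet_Icc).mpr (integrableOn_const (by simp))
  refine ((integrable_abs_rpow_indicator ha).mul_prod (h1.mul_prod h1)).mono'
    (hm.comp_measurePreserving (measurePreserving_orthonormal_coordinates h)) ?_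
  refine Eventually.of_forall fun p => ?_
  obtain ⟨t, p, q⟩ := p
  set y : E3 := t • (ξ : E3) + (p • u + q • v) with hy
  obtain ⟨b0, b1, b2⟩ := h.abs_coordinates_le t p q
  have ht : inner ℝ y (ξ : E3) = t := (h.inner_coordinates t p q).1
  by_cases hball : y ∈ Metric.ball (0 : E3) 1
  · have hlt : ‖y‖ < 1 := by simpa using hball
    have hbt : t ∈ Icc (-1 : ℝ) 1 := abs_le.mp (b0.trans hlt.le)
    have hbp : p ∈ Icc (-1 : ℝ) 1 := abs_le.mp (b1.trans hlt.le)
    have hbq : q ∈ Icc (-1 : ℝ) 1 := abs_le.mp (b2.trans hlt.le)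
    rw [Function.comp_apply, indicator_of_mem hball, indicator_of_mem hbt, indicator_of_mem hbp,
      indicator_of_mem hbq, ht, Complex.norm_real, Real.norm_of_nonneg (by positivity)]
    simp
  · rw [Function.comp_apply, indicator_of_notMem hball, norm_zero]
    refine mul_nonneg (indicator_nonneg (fun _ _ => by positivity) _)
      (mul_nonneg (indicator_nonneg (fun _ _ => zero_le_one) _)
      (indicator_nonneg (fun _ _ => zero_le_one) _))

/-- Polar coordinates on the ball give integrability over almost every sphere of radius `r < 1`. One
such radius suffices, since homogeneity relates it to the unit sphere by the constant `r^(-a)`. -/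
theorem integrable_abs_inner_rpow (ξ : S2) {a : ℝ} (ha : a < 1) :
    Integrable (fun x : S2 => |inner ℝ (x : E3) (ξ : E3)| ^ (-a)) surfaceMeasure := by
  have h := integrable_ball_abs_inner_rpow ξ ha
  have h2 := ((integrable_polar_iff h.aestronglyMeasurable).mpr h).prod_left_ae
  have h3 : ∃ r : ℝ, 0 < r ∧ r < 1 ∧ Integrable (fun x : S2 => (r ^ 2 : ℝ) •
      (Metric.ball (0 : E3) 1).indicator (fun y => ((|inner ℝ y (ξ : E3)| ^ (-a) : ℝ) : ℂ))
        (r • (x : E3))) surfaceMeasure := by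
    rw [ae_restrict_iff' measurableSet_Ioi] at h2
    have h4 : volume (Ioo (0 : ℝ) 1) ≠ 0 := by simp
    obtain ⟨r, hr, hr'⟩ := (frequently_ae_mem_iff.mpr h4).and_eventually h2 |>.exists
    exact ⟨r, hr.1, hr.2, hr' hr.1⟩
  obtain ⟨r, hr0, hr1, hr⟩ := h3
  have hcoef : (r ^ 2 * r ^ (-a)) ≠ 0 := by positivity
  refine (((hr.norm).const_mul (r ^ 2 * r ^ (-a))⁻¹)).congr (Eventually.of_forall fun x => ?_)
  have hmem : r • (x : E3) ∈ Metric.ball (0 : E3) 1 := by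
    simp [norm_smul, abs_of_pos hr0, hr1]
  beta_reduce
  rw [indicator_of_mem hmem, norm_smul, Complex.norm_real, Real.norm_of_nonneg (by positivity),
    Real.norm_of_nonneg (by positivity), real_inner_smul_left, abs_mul, abs_of_pos hr0,
    Real.mul_rpow hr0.le (abs_nonneg _)]
  field_simp

/-! ### The formula for `2 < s < 3` -/

theorem IsProfile.sq_mul {ψ : ℝ → ℂ} (hψ : IsProfile ψ) :
    IsProfile (fun r => ((r ^ 2 : ℝ) : ℂ) * ψ r) := by
  refine ⟨?_, hψ.compact.mul_left, (closure_mono ?_).trans hψ.support⟩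
  · exact (Complex.ofRealCLM.contDiff.comp (contDiff_id.pow 2)).mul hψ.contDiff
  · exact Function.support_mul_subset_right _ _

theorem mellin_sq_mul (ψ : ℝ → ℂ) (z : ℂ) :
    mellin (fun r => ((r ^ 2 : ℝ) : ℂ) * ψ r) z = mellin ψ (z + 2) := by
  rw [← mellin_cpow_smul ψ z 2]
  congr 1 with r
  simp

section
variable {ψ : ℝ → ℂ} (hψ : IsProfile ψ) {Θ : S2 → ℂ} (hΘ : ContMDiff (𝓡 2) 𝓘(ℝ, ℂ) ∞ Θ)
include hψ hΘ

/-- In polar coordinates the phase depends on `r` only through `r t (x·ξ)`. The radial integral,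
with its Jacobian `r²`, is therefore a one-dimensional Fourier transform. -/
theorem fourier_polarProduct (ξ : S2) (t : ℝ) :
    Integrable (fun x : S2 => Θ x * 𝓕 (fun r : ℝ => ((r ^ 2 : ℝ) : ℂ) * ψ r)
        (t * inner ℝ (x : E3) (ξ : E3))) surfaceMeasure ∧
    𝓕 (polarSchwartz hψ hΘ) (t • (ξ : E3)) = ∫ x : S2, Θ x *
      𝓕 (fun r : ℝ => ((r ^ 2 : ℝ) : ℂ) * ψ r) (t * inner ℝ (x : E3) (ξ : E3))
        ∂surfaceMeasure := by
  set χ : ℝ → ℂ := fun r : ℝ => ((r ^ 2 : ℝ) : ℂ) * ψ r with hχ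
  have hcont : Continuous (𝓕 χ) := hψ.sq_mul.rapidDecay_fourier.continuous
  refine ⟨?_, ?_⟩
  · have hc : Continuous (fun x : S2 => Θ x * 𝓕 χ (t * inner ℝ (x : E3) (ξ : E3))) := by
      have := hΘ.continuous
      fun_prop
    exact hc.integrable_of_hasCompactSupport (HasCompactSupport.of_compactSpace _)
  rw [SchwartzMap.fourier_coe, Real.fourier_eq]
  set f : E3 → ℂ := fun y => Real.fourierChar (-inner ℝ y (t • (ξ : E3))) • polarSchwartz hψ hΘ y
  have hf : Integrable f :=
    (Real.fourierIntegral_convergent_iff (t • (ξ : E3))).mpr (polarSchwartz hψ hΘ).integrable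
  rw [integral_polar hf.aestronglyMeasurable, integral_prod _
    ((integrable_polar_iff hf.aestronglyMeasurable).mpr hf)]
  congr 1 with x
  -- The profile vanishes on `(-∞, 0]`, so the Fourier integral over the line is the radial integral
  -- over the half-line.
  have e0 : ∀ c : ℝ, ∫ r : ℝ, Real.fourierChar (-inner ℝ r c) • χ r =
      ∫ r in Ioi (0 : ℝ), Real.fourierChar (-inner ℝ r c) • χ r := fun c =>
    (setIntegral_eq_integral_of_forall_compl_eq_zero fun r hr => by
      simp [χ, hψ.eq_zero_of_nonpos (not_lt.mp hr)]).symm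
  rw [Real.fourier_eq, e0, ← integral_const_mul]
  refine setIntegral_congr_fun measurableSet_Ioi fun r hr => ?_
  simp only [f, χ]
  rw [polarSchwartz_apply, polarProduct_smul_coe _ _ hr]
  simp only [Circle.smul_def, Complex.real_smul, smul_eq_mul]
  rw [real_inner_smul_left, real_inner_smul_right]
  have e : inner ℝ r (t * inner ℝ (x : E3) (ξ : E3)) = r * (t * inner ℝ (x : E3) (ξ : E3)) := by
    simp [mul_comm]
  rw [e]
  ring

theorem fourier_polarSchwartz_neg (heven : ∀ x : S2, Θ (-x) = Θ x) (η : E3) :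
    𝓕 (polarSchwartz hψ hΘ) (-η) = 𝓕 (polarSchwartz hψ hΘ) η := by
  rw [SchwartzMap.fourier_coe, Real.fourier_eq, Real.fourier_eq,
    ← integral_neg_eq_self]
  congr 1 with y
  rw [inner_neg_neg]
  congr 1
  rw [polarSchwartz_apply, polarSchwartz_apply]
  by_cases hy : y = 0
  · simp [hy]
  · rw [polarProduct, polarProduct, norm_neg, angle_neg hy, heven]

/-- Averaging the values at `t` and `-t` replaces the transform of `r² ψ` by an even function, which
sees only `|x·ξ|`. -/
theorem fourier_polarSchwartz_eq_integral_cos (heven : ∀ x : S2, Θ (-x) = Θ x) (ξ : S2) (t : ℝ) :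
    𝓕 (polarSchwartz hψ hΘ) (t • (ξ : E3)) = ∫ x : S2, (1 / 2 : ℂ) * (Θ x *
      (fun u => 𝓕 (fun r : ℝ => ((r ^ 2 : ℝ) : ℂ) * ψ r) u +
        𝓕 (fun r : ℝ => ((r ^ 2 : ℝ) : ℂ) * ψ r) (-u)) (t • inner ℝ (x : E3) (ξ : E3)))
        ∂surfaceMeasure := by
  obtain ⟨i1, h1⟩ := fourier_polarProduct hψ hΘ ξ t
  obtain ⟨i2, h2⟩ := fourier_polarProduct hψ hΘ ξ (-t)
  rw [neg_smul, fourier_polarSchwartz_neg hψ hΘ heven] at h2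
  rw [integral_const_mul]
  simp only [mul_add, smul_eq_mul, ← neg_mul]
  rw [integral_add i1 i2, ← h1, ← h2]
  ring

/-- The formula for the angular part of the Fourier transform when `2 < s < 3`. -/
theorem fourierAngular_eq_integral (heven : ∀ x : S2, Θ (-x) = Θ x) (ξ : S2) {s : ℝ} (hs : 2 < s)
    (hs' : s < 3) :
    fourierAngular hψ hΘ ξ s = mellin ψ s * ((tau (3 - s) : ℂ) *
      ∫ x : S2, ((|inner ℝ (x : E3) (ξ : E3)| ^ (s - 3) : ℝ) : ℂ) * Θ x ∂surfaceMeasure) := by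
  set χ : ℝ → ℂ := fun r : ℝ => ((r ^ 2 : ℝ) : ℂ) * ψ r with hχ
  have hχp : IsProfile χ := hψ.sq_mul
  set L : ℝ → ℂ := fun u => 𝓕 χ u + 𝓕 χ (-u) with hL
  have hLd : RapidDecay L := hχp.rapidDecay_fourier.add_comp_neg
  set a : ℝ := 3 - s with ha
  have ha0 : 0 < a := by linarith
  have ha1 : a < 1 := by linarith
  have ha0' : 0 < (a : ℂ).re := by simpa using ha0
  obtain ⟨CΘ, hCΘ⟩ := isCompact_univ.exists_bound_of_continuousOn hΘ.continuous.continuousOn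
  set F : S2 × ℝ → ℂ := fun p => (1 / 2 * Θ p.1) * ((p.2 : ℂ) ^ ((a : ℂ) - 1) *
    L (p.2 • inner ℝ (p.1 : E3) (ξ : E3))) with hF
  have hm : AEStronglyMeasurable F (surfaceMeasure.prod (volume.restrict (Ioi 0))) := by
    have h1 : Measurable (fun p : S2 × ℝ => (p.2 : ℂ) ^ ((a : ℂ) - 1)) := by fun_prop
    have h2 : Measurable (fun p : S2 × ℝ => L (p.2 • inner ℝ (p.1 : E3) (ξ : E3))) :=
      (hLd.continuous.comp (by fun_prop)).measurable
    have h3 : Measurable (fun p : S2 × ℝ => 1 / 2 * Θ p.1) :=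
      ((continuous_const.mul hΘ.continuous).comp continuous_fst).measurable
    exact (h3.mul (h1.mul h2)).aestronglyMeasurable
  obtain ⟨C, hC⟩ := exists_integral_norm_ray_le hLd ha0'
  -- The absolute integral in `t` is at most a constant times `|x·ξ|^(-a)`, integrable on the sphere
  -- because `a = 3 - s < 1`. This is where `s > 2` enters the exchange of integrals.
  have hint : Integrable F (surfaceMeasure.prod (volume.restrict (Ioi 0))) := by
    rw [integrable_prod_iff hm]
    constructor
    · filter_upwards [ae_inner_ne_zero ξ] with x hx
      exact Integrable.const_mul (hLd.mellinConvergent_ray hx ha0') (1 / 2 * Θ x)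
    · refine ((integrable_abs_inner_rpow ξ ha1).const_mul (1 / 2 * CΘ * C)).mono'
        hm.norm.integral_prod_right' ?_
      filter_upwards [ae_inner_ne_zero ξ] with x hx
      rw [Real.norm_of_nonneg (integral_nonneg fun _ => norm_nonneg _)]
      simp_rw [hF, norm_mul (1 / 2 * Θ x)]
      rw [integral_const_mul, mul_assoc (1 / 2 * CΘ)]
      have h1 := hC _ hx
      rw [Complex.ofReal_re, Real.norm_eq_abs] at h1
      refine mul_le_mul ?_ h1 (integral_nonneg fun _ => norm_nonneg _) ?_
      · rw [norm_mul]
        gcongr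
        · norm_num
        · exact hCΘ x (mem_univ _)
      · have := (norm_nonneg _).trans (hCΘ x (mem_univ _))
        positivity
  have hLneg : ∀ u, L (-u) = L u := fun u => by simp only [hL, neg_neg, add_comm]
  have hray : ∀ x : S2, inner ℝ (x : E3) (ξ : E3) ≠ 0 →
      mellin (fun t : ℝ => L (t • inner ℝ (x : E3) (ξ : E3))) a =
        ((|inner ℝ (x : E3) (ξ : E3)| ^ (s - 3) : ℝ) : ℂ) * mellin L a := by
    intro x hx
    have h1 := mellin_comp_mul_right L (a : ℂ) (abs_pos.mpr hx)
    rw [smul_eq_mul] at h1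
    have h2 : (s - 3 : ℝ) = -a := by rw [ha]; ring
    rw [h2, Complex.ofReal_cpow (abs_nonneg _), Complex.ofReal_neg, ← h1]
    congr 1 with t
    rcases abs_choice (inner ℝ (x : E3) (ξ : E3)) with h | h
    · rw [h, smul_eq_mul]
    · rw [h, mul_neg, hLneg, smul_eq_mul]
  -- The Jacobian shifts the Mellin exponent by `2`, and `(1 - a) + 2 = s`.
  have hval : mellin L a = 2 * tau a * mellin ψ s := by
    rw [hL, hχp.mellin_fourier_add_comp_neg ha0 ha1, hχ, mellin_sq_mul]
    congr 2
    rw [ha]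
    push_cast
    ring
  calc fourierAngular hψ hΘ ξ s
      = mellin (fun t : ℝ => 𝓕 (polarSchwartz hψ hΘ) (t • (ξ : E3))) a := by
        rw [fourierAngular, ha]
        push_cast
        rfl
    _ = ∫ t in Ioi (0 : ℝ), ∫ x : S2, F (x, t) ∂surfaceMeasure := by
        rw [mellin]
        congr 1 with t
        rw [fourier_polarSchwartz_eq_integral_cos hψ hΘ heven ξ t, smul_eq_mul,
          ← integral_const_mul]
        congr 1 with x
        simp only [hF, hL]
        ring
    _ = ∫ x : S2, (∫ t in Ioi (0 : ℝ), F (x, t)) ∂surfaceMeasure := 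
        (integral_integral_swap (f := fun x t => F (x, t)) hint).symm
    _ = ∫ x : S2, (mellin ψ s * tau a) * (((|inner ℝ (x : E3) (ξ : E3)| ^ (s - 3) : ℝ) : ℂ) * Θ x)
          ∂surfaceMeasure := by
        refine integral_congr_ae ?_
        filter_upwards [ae_inner_ne_zero ξ] with x hx
        have h1 : ∫ t in Ioi (0 : ℝ), F (x, t) =
            (1 / 2 * Θ x) * mellin (fun t : ℝ => L (t • inner ℝ (x : E3) (ξ : E3))) a := by
          rw [mellin, ← integral_const_mul]
          rfl
        rw [h1, hray x hx, hval]
        ring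
    _ = _ := by rw [integral_const_mul, mul_assoc]

end

/-! ### Fourier slices and the formula at `s = 2` -/

section slice
variable {ξ u v : E3} (h : Orthonormal ℝ ![ξ, u, v])
include h

/-- Continuity is what permits pointwise Fourier inversion of the plane integrals at `t = 0`.
Compact support confines all slices to one square. -/
theorem continuous_integral_slice {G : E3 → ℂ} (hG : Continuous G) (hGc : HasCompactSupport G) :
    Continuous (fun t : ℝ => ∫ q : ℝ × ℝ, G (t • ξ + (q.1 • u + q.2 • v))) := by
  obtain ⟨C, hC⟩ := hG.bounded_above_of_compact_support hGc
  obtain ⟨R, hR⟩ := hGc.isCompact.isBounded.exists_norm_le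
  have hC0 : 0 ≤ C := (norm_nonneg _).trans (hC 0)
  refine continuous_of_dominated
    (bound := (Icc (-R) R ×ˢ Icc (-R) R).indicator fun _ => C) (fun t => ?_) (fun t => ?_) ?_ ?_
  · exact (hG.comp (by fun_prop)).aestronglyMeasurable
  · refine Eventually.of_forall fun q => ?_
    obtain ⟨-, b1, b2⟩ := h.abs_coordinates_le t q.1 q.2
    by_cases hq : G (t • ξ + (q.1 • u + q.2 • v)) = 0
    · rw [hq, norm_zero]
      exact indicator_nonneg (fun _ _ => hC0) _
    · have hn := hR _ (subset_tsupport G hq)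
      have hmem : q ∈ Icc (-R) R ×ˢ Icc (-R) R :=
        ⟨abs_le.mp (b1.trans hn), abs_le.mp (b2.trans hn)⟩
      rw [indicator_of_mem hmem]
      exact hC _
  · exact (integrable_indicator_iff (measurableSet_Icc.prod measurableSet_Icc)).mpr
      (integrableOn_const (isCompact_Icc.prod isCompact_Icc).measure_lt_top.ne)
  · exact Eventually.of_forall fun q => hG.comp (by fun_prop)

theorem integrable_integral_slice {G : E3 → ℂ} (hG : Integrable G) :
    Integrable (fun t : ℝ => ∫ q : ℝ × ℝ, G (t • ξ + (q.1 • u + q.2 • v))) :=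
  ((measurePreserving_orthonormal_coordinates h).integrable_comp hG.aestronglyMeasurable).mpr
    hG |>.integral_prod_left

/-- The Fourier slice theorem for planes. -/
theorem fourier_integral_slice {G : E3 → ℂ} (hG : Integrable G) (τ : ℝ) :
    𝓕 (fun t : ℝ => ∫ q : ℝ × ℝ, G (t • ξ + (q.1 • u + q.2 • v))) τ = 𝓕 G (τ • ξ) := by
  rw [Real.fourier_eq, Real.fourier_eq]
  set f : E3 → ℂ := fun y => Real.fourierChar (-inner ℝ y (τ • ξ)) • G y with hf
  have hfi : Integrable f := (Real.fourierIntegral_convergent_iff (τ • ξ)).mpr hG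
  have hmp := measurePreserving_orthonormal_coordinates h
  have hfubini := integral_prod (μ := (volume : Measure ℝ)) (ν := (volume : Measure (ℝ × ℝ))) _
    ((hmp.integrable_comp hfi.aestronglyMeasurable).mpr hfi)
  rw [← Measure.volume_eq_prod] at hfubini
  rw [← hmp.map_eq, integral_map hmp.aemeasurable
    (by rw [hmp.map_eq]; exact hfi.aestronglyMeasurable)]
  refine Eq.trans ?_ hfubini.symm
  congr 1 with t
  rw [Circle.smul_def, ← integral_smul]
  congr 1 with q
  simp only [hf, Function.comp_apply]
  rw [real_inner_smul_right, (h.inner_coordinates t q.1 q.2).1, Circle.smul_def]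
  simp

/-- Fourier inversion at `0` for the function `t ↦` integral of `G` over the plane at height `t`,
whose transform is `𝓕 G` along the line spanned by `ξ`. -/
theorem integral_fourier_ray_eq_integral_plane {G : 𝓢(E3, ℂ)} (hGc : HasCompactSupport G) :
    ∫ τ : ℝ, 𝓕 G (τ • ξ) = ∫ q : ℝ × ℝ, G (q.1 • u + q.2 • v) := by
  set g : ℝ → ℂ := fun t : ℝ => ∫ q : ℝ × ℝ, G (t • ξ + (q.1 • u + q.2 • v)) with hg
  have hgF : 𝓕 g = fun τ : ℝ => 𝓕 G (τ • ξ) := funext fun τ => fourier_integral_slice h G.integrable τ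
  have hi : Integrable (𝓕 g) := by
    rw [hgF]
    exact ((𝓕 G).rapidDecay.comp_smul_unit (h.1 0)).integrable
  have hinv := (integrable_integral_slice h G.integrable).fourierInv_fourier_eq hi
    (continuous_integral_slice h G.continuous hGc).continuousAt (v := 0)
  rw [Real.fourierInv_eq] at hinv
  simp only [inner_zero_right, AddChar.map_zero_eq_one, one_smul] at hinv
  rw [hgF] at hinv
  rw [hinv]
  simp

theorem norm_cos_smul_add_sin_smul (θ : ℝ) : ‖Real.cos θ • u + Real.sin θ • v‖ = 1 := by
  have ho := orthonormal_iff_ite.mp h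
  have e1 : ‖u‖ = 1 := h.1 1
  have e2 : ‖v‖ = 1 := h.1 2
  have e12 : inner ℝ u v = (0 : ℝ) := by simpa using ho 1 2
  rw [← sq_eq_sq₀ (norm_nonneg _) zero_le_one, norm_add_sq_real, norm_smul, norm_smul, e1, e2,
    real_inner_smul_left, real_inner_smul_right, e12]
  simp

/-- Polar coordinates in the plane separate the variables; the Jacobian `r` is the Mellin weight of
exponent `2`. -/
theorem integral_polarProduct_plane (ψ : ℝ → ℂ) (Θ : S2 → ℂ) :
    ∫ q : ℝ × ℝ, polarProduct ψ Θ (q.1 • u + q.2 • v) =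
      mellin ψ 2 * (2 * π * circleMean Θ u v) := by
  have hsm : ∀ p ∈ polarCoord.target, p.1 • (fun q : ℝ × ℝ =>
      polarProduct ψ Θ (q.1 • u + q.2 • v)) (polarCoord.symm p) =
      ((p.1 : ℂ) * ψ p.1) * Θ (angle (Real.cos p.2 • u + Real.sin p.2 • v)) := by
    rintro ⟨r, θ⟩ hp
    have hr : 0 < r := by simpa using hp.1
    have hn := norm_cos_smul_add_sin_smul h θ
    have hne : Real.cos θ • u + Real.sin θ • v ≠ 0 := fun h0 => by simp [h0] at hn
    have e : (r * Real.cos θ) • u + (r * Real.sin θ) • v =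
        r • (Real.cos θ • u + Real.sin θ • v) := by module
    simp only [polarCoord_symm_apply, e]
    rw [polarProduct, angle_smul hr _ hne, norm_smul, hn, mul_one, Real.norm_of_nonneg hr.le,
      Complex.real_smul, mul_assoc]
  rw [← integral_comp_polarCoord_symm, setIntegral_congr_fun polarCoord.open_target.measurableSet hsm,
    polarCoord_target, Measure.volume_eq_prod,
    setIntegral_prod_mul (fun r : ℝ => (r : ℂ) * ψ r)
      (fun θ : ℝ => Θ (angle (Real.cos θ • u + Real.sin θ • v)))]
  congr 1
  · refine setIntegral_congr_fun measurableSet_Ioi fun r _ => ?_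
    norm_num
  · have hper : Function.Periodic (fun θ : ℝ => Θ (angle (Real.cos θ • u + Real.sin θ • v)))
      (2 * π) := fun θ => by simp
    have h1 := hper.intervalIntegral_add_eq (-π) 0
    rw [zero_add, show -π + 2 * π = π by ring] at h1
    rw [circleMean, ← h1, intervalIntegral.integral_of_le (by linarith [Real.pi_pos]),
      integral_Ioc_eq_integral_Ioo, ← mul_assoc, mul_inv_cancel₀ (by
        simp [Real.pi_ne_zero]), one_mul]

end slice

/-- The formula for the angular part of the Fourier transform at `s = 2`. -/
theorem fourierAngular_two {ψ : ℝ → ℂ} (hψ : IsProfile ψ) {Θ : S2 → ℂ}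
    (hΘ : ContMDiff (𝓡 2) 𝓘(ℝ, ℂ) ∞ Θ) (heven : ∀ x : S2, Θ (-x) = Θ x) (ξ : S2) :
    fourierAngular hψ hΘ ξ 2 = mellin ψ 2 * (π * greatCircleMean Θ ξ) := by
  obtain ⟨⟨u, v⟩, h⟩ := exists_orthonormal_triple ξ
  rw [greatCircleMean_eq Θ ξ u v h]
  have h1 := integral_fourier_ray_eq_integral_plane h (G := polarSchwartz hψ hΘ)
    (hasCompactSupport_polarProduct hψ Θ)
  have h2 : ∫ q : ℝ × ℝ, polarSchwartz hψ hΘ (q.1 • u + q.2 • v) = _ :=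
    integral_polarProduct_plane h ψ Θ
  set f : ℝ → ℂ := fun t => 𝓕 (polarSchwartz hψ hΘ) (t • (ξ : E3)) with hf
  have hneg : ∀ t, f (-t) = f t := fun t => by
    simp only [hf, neg_smul, fourier_polarSchwartz_neg hψ hΘ heven]
  have hconv : MellinConvergent f 1 :=
    (𝓕 (polarSchwartz hψ hΘ)).rapidDecay.mellinConvergent_ray (coe_S2_ne_zero ξ) (by simp)
  -- At `s = 2` the exponent `3 - s` is `1`, so the Mellin weight is trivial. By evenness the
  -- half-line integral is half the line integral, which turns `2π` into `π`.
  have h3 := mellin_add_comp_neg hconv (by simpa only [hneg] using hconv)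
  simp only [hneg, sub_self, Complex.cpow_zero, mul_one] at h3
  rw [(hasMellin_add hconv hconv).2, h1, h2] at h3
  have h4 : fourierAngular hψ hΘ ξ 2 = mellin f 1 := by
    rw [fourierAngular]
    norm_num
    rfl
  rw [h4]
  linear_combination h3 / 2

/-! ### Independence of the profile and the normalized angular function -/

theorem isOpen_strip : IsOpen strip :=
  (isOpen_lt continuous_const Complex.continuous_re).inter
    (isOpen_lt Complex.continuous_re continuous_const)

theorem isPreconnected_strip : IsPreconnected strip := by
  have h : strip = Complex.reLm ⁻¹' Ioo (0 : ℝ) 3 := rfl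
  rw [h]
  exact ((convex_Ioo (0 : ℝ) 3).linear_preimage Complex.reLm).isPreconnected

/-- Every point of the plane is the argument of a nonzero Mellin transform of a profile. -/
theorem exists_isProfile_mellin_ne_zero (s : ℂ) : ∃ ψ : ℝ → ℂ, IsProfile ψ ∧ mellin ψ s ≠ 0 := by
  let b : ContDiffBump (2 : ℝ) := ⟨1 / 2, 1, by norm_num, by norm_num⟩
  have hts : tsupport (b : ℝ → ℝ) ⊆ Ioi 0 := by
    rw [b.tsupport_eq]
    intro x hx
    rw [Metric.mem_closedBall, Real.dist_eq, abs_le] at hx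
    have : b.rOut = 1 := rfl
    rw [mem_Ioi]
    linarith [hx.1]
  -- The factor `r^(1 - s)` cancels the Mellin weight `r^(s - 1)`, leaving the positive integral of
  -- the bump.
  set ψ : ℝ → ℂ := fun r => (r : ℂ) ^ (1 - s) * ((b r : ℝ) : ℂ) with hψ
  have hsub : Function.support ψ ⊆ Function.support (b : ℝ → ℝ) := fun r hr h0 => hr (by
    simp [hψ, show b r = 0 from h0])
  have hsub' : tsupport ψ ⊆ tsupport (b : ℝ → ℝ) := closure_mono hsub
  refine ⟨ψ, ⟨?_, b.hasCompactSupport.mono hsub, hsub'.trans hts⟩, ?_⟩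
  · rw [contDiff_iff_contDiffAt]
    intro r
    by_cases hr : r ∈ tsupport ψ
    · have hr0 : 0 < r := hts (hsub' hr)
      refine ContDiffAt.mul ?_ (Complex.ofRealCLM.contDiff.contDiffAt.comp r b.contDiff.contDiffAt)
      have h1 : (fun t : ℝ => (t : ℂ) ^ (1 - s)) =ᶠ[𝓝 r]
          fun t : ℝ => Complex.exp ((Real.log t : ℂ) * (1 - s)) := by
        filter_upwards [Ioi_mem_nhds hr0] with t ht
        rw [mem_Ioi] at ht
        rw [Complex.cpow_def_of_ne_zero (by exact_mod_cast ht.ne'), Complex.ofReal_log ht.le]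
      refine ContDiffAt.congr_of_eventuallyEq ?_ h1
      refine ContDiffAt.cexp (ContDiffAt.mul ?_ contDiffAt_const)
      exact Complex.ofRealCLM.contDiff.contDiffAt.comp r (Real.contDiffAt_log.mpr hr0.ne')
    · exact (contDiffAt_const (c := (0 : ℂ))).congr_of_eventuallyEq
        (notMem_tsupport_iff_eventuallyEq.mp hr)
  · have h1 : mellin ψ s = ∫ r in Ioi (0 : ℝ), ((b r : ℝ) : ℂ) := by
      refine setIntegral_congr_fun measurableSet_Ioi fun r hr => ?_
      have hr0 : (r : ℂ) ≠ 0 := by exact_mod_cast (mem_Ioi.mp hr).ne'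
      simp only [hψ]
      rw [smul_eq_mul, ← mul_assoc, ← Complex.cpow_add _ _ hr0]
      simp
    rw [h1, setIntegral_eq_integral_of_forall_compl_eq_zero (fun r hr => by
      have h0 : b r = 0 := by
        by_contra h0
        exact hr (hts (subset_tsupport _ h0))
      rw [h0, Complex.ofReal_zero]), integral_complex_ofReal]
    exact_mod_cast b.integral_pos.ne'

/-- A profile whose Mellin transform does not vanish at `s`. -/
noncomputable def profileAt (s : ℂ) : ℝ → ℂ := (exists_isProfile_mellin_ne_zero s).choose

theorem isProfile_profileAt (s : ℂ) : IsProfile (profileAt s) :=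
  (exists_isProfile_mellin_ne_zero s).choose_spec.1

theorem mellin_profileAt_ne_zero (s : ℂ) : mellin (profileAt s) s ≠ 0 :=
  (exists_isProfile_mellin_ne_zero s).choose_spec.2

section
variable {Θ : S2 → ℂ} (hΘ : ContMDiff (𝓡 2) 𝓘(ℝ, ℂ) ∞ Θ)

theorem differentiableOn_fourierAngular {ψ : ℝ → ℂ} (hψ : IsProfile ψ) (ξ : S2) :
    DifferentiableOn ℂ (fourierAngular hψ hΘ ξ) strip := fun _ hs =>
  (hasDerivAt_fourierAngular hψ hΘ ξ hs.2).differentiableAt.differentiableWithinAt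

/-- Up to the Mellin transform of the profile, `fourierAngular` does not depend on the profile. -/
theorem fourierAngular_mul_mellin_comm (heven : ∀ x : S2, Θ (-x) = Θ x) {ψ χ : ℝ → ℂ}
    (hψ : IsProfile ψ) (hχ : IsProfile χ) (ξ : S2) {s : ℂ} (hs : s ∈ strip) :
    fourierAngular hψ hΘ ξ s * mellin χ s = fourierAngular hχ hΘ ξ s * mellin ψ s := by
  have hd : ∀ {ψ χ : ℝ → ℂ} (hψ : IsProfile ψ), IsProfile χ →
      AnalyticOnNhd ℂ (fun s => fourierAngular hψ hΘ ξ s * mellin χ s) strip := fun hψ hχ =>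
    ((differentiableOn_fourierAngular hΘ hψ ξ).mul
      hχ.differentiable_mellin.differentiableOn).analyticOnNhd isOpen_strip
  -- On `(2, 3)` the explicit formula makes both products equal to the same spherical integral times
  -- both Mellin transforms. The identity theorem at `5/2` extends the equality to the strip.
  have hmem : ((5 / 2 : ℝ) : ℂ) ∈ strip := by
    constructor <;> simp only [Complex.ofReal_re] <;> norm_num
  refine (hd hψ hχ).eqOn_of_preconnected_of_frequently_eq (hd hχ hψ) isPreconnected_strip hmem
    ?_ hs
  have hfreq : ∃ᶠ r : ℝ in 𝓝[≠] (5 / 2 : ℝ), fourierAngular hψ hΘ ξ r * mellin χ r =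
      fourierAngular hχ hΘ ξ r * mellin ψ r := by
    refine Eventually.frequently ?_
    filter_upwards [mem_nhdsWithin_of_mem_nhds (Ioo_mem_nhds (by norm_num : (2 : ℝ) < 5 / 2)
      (by norm_num : (5 / 2 : ℝ) < 3))] with r hr
    rw [fourierAngular_eq_integral hψ hΘ heven ξ hr.1 hr.2,
      fourierAngular_eq_integral hχ hΘ heven ξ hr.1 hr.2]
    ring
  refine Tendsto.frequently ?_ hfreq
  refine tendsto_nhdsWithin_iff.mpr ⟨(Complex.continuous_ofReal.tendsto _).mono_left
    nhdsWithin_le_nhds, ?_⟩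
  filter_upwards [self_mem_nhdsWithin] with r hr h0
  exact hr (Complex.ofReal_injective h0)

/-- The angular function `Θ̃(ξ; s)` of the Fourier transform of `|x|^{-s} Θ(x̄)`. -/
noncomputable def fourierTilde (hΘ : ContMDiff (𝓡 2) 𝓘(ℝ, ℂ) ∞ Θ) (ξ : S2) (s : ℂ) : ℂ :=
  fourierAngular (isProfile_profileAt s) hΘ ξ s / mellin (profileAt s) s

theorem fourierTilde_eq (heven : ∀ x : S2, Θ (-x) = Θ x) {ψ : ℝ → ℂ} (hψ : IsProfile ψ) (ξ : S2)
    {s : ℂ} (hs : s ∈ strip) (h0 : mellin ψ s ≠ 0) :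
    fourierTilde hΘ ξ s = fourierAngular hψ hΘ ξ s / mellin ψ s := by
  rw [fourierTilde, div_eq_div_iff (mellin_profileAt_ne_zero s) h0]
  exact fourierAngular_mul_mellin_comm hΘ heven _ _ ξ hs

/-- The profile in `fourierTilde` is chosen separately at each `s`, so regularity in `s` is not
visible from the definition. Near a given point the profile chosen there still has nonzero Mellin
transform and may be used throughout. -/
theorem fourierTilde_eventuallyEq (heven : ∀ x : S2, Θ (-x) = Θ x) (ξ : S2) {s : ℂ}
    (hs : s ∈ strip) : fourierTilde hΘ ξ =ᶠ[𝓝 s] fun z =>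
      fourierAngular (isProfile_profileAt s) hΘ ξ z / mellin (profileAt s) z := by
  have hc := (isProfile_profileAt s).differentiable_mellin.continuous.continuousAt (x := s)
  filter_upwards [isOpen_strip.mem_nhds hs, hc.eventually_ne (mellin_profileAt_ne_zero s)]
    with z hz hz0
  exact fourierTilde_eq hΘ heven _ ξ hz hz0

theorem hasDerivAt_fourierTilde (heven : ∀ x : S2, Θ (-x) = Θ x) (ξ : S2) {s : ℂ}
    (hs : s ∈ strip) : HasDerivAt (fourierTilde hΘ ξ)
      ((deriv (fourierAngular (isProfile_profileAt s) hΘ ξ) s * mellin (profileAt s) s -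
        fourierAngular (isProfile_profileAt s) hΘ ξ s * deriv (mellin (profileAt s)) s) /
          mellin (profileAt s) s ^ 2) s := by
  refine HasDerivAt.congr_of_eventuallyEq ?_ (fourierTilde_eventuallyEq hΘ heven ξ hs)
  exact (hasDerivAt_fourierAngular _ hΘ ξ hs.2).differentiableAt.hasDerivAt.fun_div
    ((isProfile_profileAt s).differentiable_mellin s).hasDerivAt (mellin_profileAt_ne_zero s)

theorem ContMDiff.mul_const_complex {f : S2 → ℂ} (hf : ContMDiff (𝓡 2) 𝓘(ℝ, ℂ) ∞ f) (c : ℂ) :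
    ContMDiff (𝓡 2) 𝓘(ℝ, ℂ) ∞ (fun ξ => f ξ * c) :=
  (contDiff_id.mul contDiff_const : ContDiff ℝ ∞ fun z : ℂ => z * c).contMDiff.comp hf

theorem contMDiff_fourierTilde {s : ℂ} (hs : s ∈ strip) :
    ContMDiff (𝓡 2) 𝓘(ℝ, ℂ) ∞ (fun ξ => fourierTilde hΘ ξ s) := by
  simp only [fourierTilde, div_eq_mul_inv]
  exact (contMDiff_fourierAngular _ hΘ hs.2).mul_const_complex _

theorem contMDiff_deriv_fourierTilde (heven : ∀ x : S2, Θ (-x) = Θ x) {s : ℂ} (hs : s ∈ strip) :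
    ContMDiff (𝓡 2) 𝓘(ℝ, ℂ) ∞ (fun ξ => deriv (fourierTilde hΘ ξ) s) := by
  simp_rw [fun ξ => (hasDerivAt_fourierTilde hΘ heven ξ hs).deriv, div_eq_mul_inv]
  exact (((contMDiff_deriv_fourierAngular _ hΘ hs.2).mul_const_complex _).sub
    ((contMDiff_fourierAngular _ hΘ hs.2).mul_const_complex _)).mul_const_complex _

theorem hasFourierTransform_fourierTilde {s : ℂ} (hs : s ∈ strip) :
    HasFourierTransform (homogeneous (-s) Θ)
      (homogeneous (s - 3) (fun ξ => fourierTilde hΘ ξ s)) := by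
  refine hasFourierTransform_homogeneous ?_ ?_ hΘ.continuous
    (contMDiff_fourierTilde hΘ hs).continuous fun φ => ?_
  · rw [Complex.neg_re]
    linarith [hs.2]
  · have : (s - 3).re = s.re - 3 := by simp
    rw [this]
    linarith [hs.1]
  · have h := integral_fourier_mul_homogeneous (isProfile_profileAt s) hΘ φ hs
    have h0 := mellin_profileAt_ne_zero s
    -- The duality holds only after multiplication by the Mellin transform of the profile; its
    -- nonvanishing at `s` allows the cancellation.
    rw [← mul_right_inj' h0, h, ← integral_const_mul]
    congr 1 with ξ
    simp only [homogeneous, fourierTilde]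
    field_simp

theorem fourierTilde_eq_integral (heven : ∀ x : S2, Θ (-x) = Θ x) (ξ : S2) {s : ℝ} (hs : 2 < s)
    (hs' : s < 3) :
    fourierTilde hΘ ξ s = (tau (3 - s) : ℂ) *
      ∫ x : S2, ((|inner ℝ (x : E3) (ξ : E3)| ^ (s - 3) : ℝ) : ℂ) * Θ x ∂surfaceMeasure := by
  rw [fourierTilde, fourierAngular_eq_integral _ hΘ heven ξ hs hs',
    mul_div_cancel_left₀ _ (mellin_profileAt_ne_zero _)]

theorem integrable_abs_inner_rpow_mul (hΘ : Continuous Θ) (ξ : S2) {s : ℝ} (hs : 2 < s) :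
    Integrable (fun x : S2 => ((|inner ℝ (x : E3) (ξ : E3)| ^ (s - 3) : ℝ) : ℂ) * Θ x)
      surfaceMeasure := by
  obtain ⟨C, hC⟩ := isCompact_univ.exists_bound_of_continuousOn hΘ.continuousOn
  have h := (integrable_abs_inner_rpow ξ (a := 3 - s) (by linarith)).ofReal (𝕜 := ℂ)
  rw [neg_sub] at h
  exact h.mul_bdd hΘ.aestronglyMeasurable (Eventually.of_forall fun x => hC x (mem_univ x))

end

end

theorem lemma2p1 (Ω : S2 → ℂ) (hsmooth : ContMDiff (𝓡 2) 𝓘(ℝ, ℂ) ∞ Ω)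
    (heven : ∀ x : S2, Ω (-x) = Ω x) :
    ∃ Ωt : S2 → ℂ → ℂ,
      -- the Fourier transform of `|x|^{-s} Ω(x̄)` is `|ξ|^{s-3} Ωt(ξ̄; s)`
      (∀ s ∈ strip,
        HasFourierTransform (homogeneous (-s) Ω) (homogeneous (s - 3) (fun ξ => Ωt ξ s))) ∧
      -- smooth in `ξ̄`
      (∀ s ∈ strip, ContMDiff (𝓡 2) 𝓘(ℝ, ℂ) ∞ (fun ξ => Ωt ξ s)) ∧
      -- holomorphic in `s`
      (∀ ξ : S2, DifferentiableOn ℂ (Ωt ξ) strip) ∧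
      -- the `s`-derivative is smooth in `ξ̄`
      (∀ s ∈ strip, ContMDiff (𝓡 2) 𝓘(ℝ, ℂ) ∞ (fun ξ => deriv (Ωt ξ) s)) ∧
      -- the formula for `2 < s < 3`, with an absolutely convergent integral
      (∀ s : ℝ, 2 < s → s < 3 → ∀ ξ : S2,
        MeasureTheory.Integrable
          (fun x : S2 => ((|inner ℝ (x : E3) (ξ : E3)| ^ (s - 3) : ℝ) : ℂ) * Ω x) surfaceMeasure ∧
        Ωt ξ (s : ℂ) = (tau (3 - s) : ℂ) *
          ∫ x : S2, ((|inner ℝ (x : E3) (ξ : E3)| ^ (s - 3) : ℝ) : ℂ) * Ω x ∂surfaceMeasure) ∧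
      -- the formula for `s = 2`
      (∀ ξ : S2, Ωt ξ 2 = (π : ℂ) * greatCircleMean Ω ξ) := by
  refine ⟨fourierTilde hsmooth, fun s hs => hasFourierTransform_fourierTilde hsmooth hs,
    fun s hs => contMDiff_fourierTilde hsmooth hs, fun ξ s hs =>
      (hasDerivAt_fourierTilde hsmooth heven ξ hs).differentiableAt.differentiableWithinAt,
    fun s hs => contMDiff_deriv_fourierTilde hsmooth heven hs, fun s hs hs' ξ =>
      ⟨integrable_abs_inner_rpow_mul hsmooth.continuous ξ hs,
        fourierTilde_eq_integral hsmooth heven ξ hs hs'⟩, fun ξ => ?_⟩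
  rw [fourierTilde, fourierAngular_two _ hsmooth heven,
    mul_div_cancel_left₀ _ (mellin_profileAt_ne_zero _)]
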